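/- **Proposition (correctness of the flow algorithm for the proximal operator).** Let $p\ge 0$, let $\mathcal G$ be a finite family of (arbitrary, possibly overlapping) subsets of $\{1,\dots,p\}$, let $\eta_g>0$ for $g\in\mathcal G$, let $\lambda\ge 0$, and put $\Omega(w)=\sum_{g\in\mathcal G}\eta_g\|w_g\|_\infty$, where $w_g=(w_j)_{j\in g}$. For $u\in\mathbb R^p$ let $\mathrm{Prox}_{\lambda\Omega}(u)$ be the unique minimizer over $w\in\mathbb R^p$ of $\frac12\|u-w\|_2^2+\lambda\Omega(w)$. *Graphs.* The canonical graph has a source $s$, a sink $t$ and the vertex set $V_0=\{1,\dots,p\}\cup\mathcal G$; its arcs are $(s,g)$ with capacity $\lambda\eta_g$ for $g\in\mathcal G$, $(g,j)$ with infinite capacity for $g\in\mathcal G$ and $j\in g$, and $(j,t)$ with infinite capacity for $1\le j\le p$. A capacitated directed graph on the same nodes, in which no arc enters $s$ or leaves $t$, is *equivalent* to it if it has the same arcs out of $s$ and into $t$, with the same capacities; if for all $g\in\mathcal G$ and $j\in g$ there is a unique directed path from $g$ to $j$ all of whose arcs have infinite capacity; and if $j\in g$ whenever there is a directed path from a vertex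 $g\in\mathcal G$ to a vertex $j\in\{1,\dots,p\}$. *Procedure.* Fix an initial graph $G_0$ and a vector $u\in\mathbb R_{\ge 0}^p$. For $V\subseteq V_0$ write $V_u=V\cap\{1,\dots,p\}$ and $V_{gr}=V\cap\mathcal G$. The procedure $\mathtt{computeFlow}(V)$ works on the subgraph of $G_0$ induced by $V\cup\{s,t\}$ as follows. 1. Let $(\gamma_j)_{j\in V_u}$ be the Euclidean projection of $(u_j)_{j\in V_u}$ onto the $\ell_1$-ball of radius $\lambda\sum_{g\in V_{gr}}\eta_g$. 2. Give each arc $(j,t)$, $j\in V_u$, the capacity $\gamma_j$, compute a maximum flow from $s$ to $t$, and let $\bar\xi_j$ be its value on $(j,t)$. 3. If $\bar\xi_j=\gamma_j$ for all $j\in V_u$, return $(\bar\xi_j)_{j\in V_u}$. Otherwise take a minimum $(s,t)$-cut of this graph, let $V^+$ and $V^-$ be the sets of vertices of $V$ on its source side and on its sink side, and return the values given by $\mathtt{computeFlow}(V^+)$ on $V^+_u$ and by $\mathtt{computeFlow}(V^-)$ on $V^-_u$. For an input $u\in\mathbb R^p$ the algorithm runs $\mathtt{computeFlow}(V_0)$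 with the vector $(|u_j|)_j$, which gives $\bar\xi$, and returns the vector $w$ with $w_j=u_j-\bar\xi_j$ if $u_j\ge 0$ and $w_j=u_j+\bar\xi_j$ if $u_j<0$; in particular $w=u-\bar\xi$ if $u\ge 0$. *Claim.* Let $G_0$ be the canonical graph or any graph equivalent to it. Then, for every $u\in\mathbb R^p$ and whatever maximum flows and minimum cuts are chosen, the recursion terminates; the algorithm returns a vector; and every vector it returns is $\mathrm{Prox}_{\lambda\Omega}(u)$. -/

import Mathlib

open scoped ENNReal

/-! ### Capacitated graphs, flows and cuts

A capacitated directed graph on a finite node type `N` with source `s` and sink `t` is given by its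
capacity function `c : N → N → ℝ≥0∞`; the arcs are the pairs of positive capacity. -/

section Networks

variable {N : Type*} [Fintype N]

/-- A flow: non-negative on arcs, within the capacities, conserved except at `s` and `t`. -/
structure IsFlow (c : N → N → ℝ≥0∞) (s t : N) (f : N → N → ℝ) : Prop where
  nonneg : ∀ a b, 0 ≤ f a b
  le_cap : ∀ a b, ENNReal.ofReal (f a b) ≤ c a b
  conserved : ∀ v, v ≠ s → v ≠ t → ∑ a, f a v = ∑ b, f v b

/-- The value of a flow: the net amount leaving the source. -/
def flowValue (s : N) (f : N → N → ℝ) : ℝ :=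
  ∑ b, f s b - ∑ a, f a s

def IsMaxFlow (c : N → N → ℝ≥0∞) (s t : N) (f : N → N → ℝ) : Prop :=
  IsFlow c s t f ∧ ∀ f', IsFlow c s t f' → flowValue s f' ≤ flowValue s f

variable [DecidableEq N]

/-- The capacity of the cut `(S, Sᶜ)`. -/
noncomputable def cutCapacity (c : N → N → ℝ≥0∞) (S : Finset N) : ℝ≥0∞ :=
  ∑ a ∈ S, ∑ b ∈ Sᶜ, c a b

/-- `S` is the source side of a minimum `(s,t)`-cut. -/
def IsMinCut (c : N → N → ℝ≥0∞) (s t : N) (S : Finset N) : Prop :=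
  s ∈ S ∧ t ∉ S ∧ ∀ S' : Finset N, s ∈ S' → t ∉ S' → cutCapacity c S ≤ cutCapacity c S'

/-- `l` is the vertex list of a directed path (without repeated vertices) from `a` to `b`. -/
def IsDirPath (c : N → N → ℝ≥0∞) (a b : N) (l : List N) : Prop :=
  l.Nodup ∧ l.head? = some a ∧ l.getLast? = some b ∧ l.IsChain (fun x y => 0 < c x y)

end Networks

/-! ### The graphs of a group structure

Variables are the indices `j : Fin p`; the groups form a finite family `grp : κ → Finset (Fin p)`
with weights `η : κ → ℝ`. The vertex set is `V = V_u ∪ V_gr = Fin p ⊕ κ`, and the nodes are the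
vertices together with the source `Sum.inl false` and the sink `Sum.inl true`. -/

abbrev Vertex (p : ℕ) (κ : Type*) := Fin p ⊕ κ

abbrev Node (p : ℕ) (κ : Type*) := Bool ⊕ Vertex p κ

section Graphs

variable {p : ℕ} {κ : Type*}

abbrev source : Node p κ := Sum.inl false

abbrev sink : Node p κ := Sum.inl true

abbrev varNode (j : Fin p) : Node p κ := Sum.inr (Sum.inl j)

abbrev grpNode (g : κ) : Node p κ := Sum.inr (Sum.inr g)

/-- The canonical graph: an arc `(s,g)` of capacity `λ η_g` for each group, an arc `(g,j)` of
infinite capacity for each `j ∈ g`, an arc `(j,t)` of infinite capacity for each variable. -/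
noncomputable def canonicalGraph (grp : κ → Finset (Fin p)) (η : κ → ℝ) (lam : ℝ) :
    Node p κ → Node p κ → ℝ≥0∞
  | Sum.inl false, Sum.inr (Sum.inr g) => ENNReal.ofReal (lam * η g)
  | Sum.inr (Sum.inr g), Sum.inr (Sum.inl j) => if j ∈ grp g then ⊤ else 0
  | Sum.inr (Sum.inl _), Sum.inl true => ⊤
  | _, _ => 0

/-- A graph on the same nodes that is equivalent to the canonical one: same arcs out of the source
and into the sink, and a unique path of infinite capacity from `g` to `j` for each `j ∈ g`, while
any path from a group `g` to a variable `j` forces `j ∈ g`. As usual in a network, no arc enters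
the source or leaves the sink. Arc costs play no role in the algorithm and are not recorded. -/
structure IsEquivalentGraph (grp : κ → Finset (Fin p)) (η : κ → ℝ) (lam : ℝ)
    (c : Node p κ → Node p κ → ℝ≥0∞) : Prop where
  into_source : ∀ v, c v source = 0
  out_of_sink : ∀ v, c sink v = 0
  out_of_source : ∀ v, c source v = canonicalGraph grp η lam source v
  into_sink : ∀ v, c v sink = canonicalGraph grp η lam v sink
  path_of_mem : ∀ g j, j ∈ grp g →
    ∃! l, IsDirPath c (grpNode g) (varNode j) l ∧ l.IsChain (fun x y => c x y = ⊤)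
  mem_of_path : ∀ g j l, IsDirPath c (grpNode g) (varNode j) l → j ∈ grp g

/-! ### The procedure `computeFlow` -/

variable [DecidableEq κ]

/-- The node is `s`, `t`, or a vertex of `V`. -/
def InCall (V : Finset (Vertex p κ)) : Node p κ → Prop
  | Sum.inl _ => True
  | Sum.inr v => v ∈ V

/-- `γ_j` is made the capacity of each arc `(j,t)`. -/
noncomputable def setSinkCapacity (c : Node p κ → Node p κ → ℝ≥0∞) (γ : Fin p → ℝ) :
    Node p κ → Node p κ → ℝ≥0∞
  | Sum.inr (Sum.inl j), Sum.inl true => ENNReal.ofReal (γ j)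
  | a, b => c a b

open Classical in
/-- The graph `(V, E, s, t)` of the max-flow step in a call on the vertex set `V`: the arcs of the
initial graph `c` between nodes of `V ∪ {s, t}`, with capacities `γ_j` on the arcs `(j,t)`. -/
noncomputable def callGraph (c : Node p κ → Node p κ → ℝ≥0∞) (V : Finset (Vertex p κ))
    (γ : Fin p → ℝ) (a b : Node p κ) : ℝ≥0∞ :=
  if InCall V a ∧ InCall V b then setSinkCapacity c γ a b else 0

def varsOf (V : Finset (Vertex p κ)) : Finset (Fin p) :=
  Finset.univ.filter fun j => Sum.inl j ∈ V

/-- The vertices of `V` on the source side (`V⁺`) and on the sink side (`V⁻`) of a cut. -/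
def plusPart (V : Finset (Vertex p κ)) (S : Finset (Node p κ)) : Finset (Vertex p κ) :=
  V.filter fun v => Sum.inr v ∈ S

def minusPart (V : Finset (Vertex p κ)) (S : Finset (Node p κ)) : Finset (Vertex p κ) :=
  V.filter fun v => Sum.inr v ∉ S

variable [Fintype κ]

def grpsOf (V : Finset (Vertex p κ)) : Finset κ :=
  Finset.univ.filter fun g => Sum.inr g ∈ V

/-- Projection step: `(γ_j)_{j ∈ V_u}` is the Euclidean projection of `(u_j)_{j ∈ V_u}` onto the
`ℓ¹`-ball of radius `λ ∑_{g ∈ V_gr} η_g`. (Values of `γ` outside `V_u` are never used.) -/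
def IsProjectionStep (η : κ → ℝ) (lam : ℝ) (u : Fin p → ℝ) (V : Finset (Vertex p κ))
    (γ : Fin p → ℝ) : Prop :=
  ∑ j ∈ varsOf V, |γ j| ≤ lam * ∑ g ∈ grpsOf V, η g ∧
  ∀ γ' : Fin p → ℝ, ∑ j ∈ varsOf V, |γ' j| ≤ lam * ∑ g ∈ grpsOf V, η g →
    ∑ j ∈ varsOf V, (1 / 2) * (u j - γ j) ^ 2 ≤ ∑ j ∈ varsOf V, (1 / 2) * (u j - γ' j) ^ 2

/-- The first part of a call on `V`: the projection step yields `γ`, then the max-flow step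
yields the flow `f`, whose values on the arcs `(j,t)` are the current `ξ̄_j`. -/
def IsFlowStep (η : κ → ℝ) (lam : ℝ) (c : Node p κ → Node p κ → ℝ≥0∞) (u : Fin p → ℝ)
    (V : Finset (Vertex p κ)) (γ : Fin p → ℝ) (f : Node p κ → Node p κ → ℝ) : Prop :=
  IsProjectionStep η lam u V γ ∧ IsMaxFlow (callGraph c V γ) source sink f

/-- `ComputeFlow η lam c u V ξ`: some terminating execution of `computeFlow` on the vertex set `V`
returns `(ξ_j)_{j ∈ V_u}`. Any maximum flow and any minimum cut may be used in each call. -/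
inductive ComputeFlow (η : κ → ℝ) (lam : ℝ) (c : Node p κ → Node p κ → ℝ≥0∞) (u : Fin p → ℝ) :
    Finset (Vertex p κ) → (Fin p → ℝ) → Prop
  | done (V : Finset (Vertex p κ)) (γ : Fin p → ℝ) (f : Node p κ → Node p κ → ℝ)
      (step : IsFlowStep η lam c u V γ f)
      (eq : ∀ j ∈ varsOf V, f (varNode j) sink = γ j) :
      ComputeFlow η lam c u V (fun j => f (varNode j) sink)
  | split (V : Finset (Vertex p κ)) (γ : Fin p → ℝ) (f : Node p κ → Node p κ → ℝ)
      (S : Finset (Node p κ)) (ξp ξm : Fin p → ℝ)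
      (step : IsFlowStep η lam c u V γ f)
      (ne : ∃ j ∈ varsOf V, f (varNode j) sink ≠ γ j)
      (cut : IsMinCut (callGraph c V γ) source sink S)
      (plus : ComputeFlow η lam c u (plusPart V S) ξp)
      (minus : ComputeFlow η lam c u (minusPart V S) ξm) :
      ComputeFlow η lam c u V (fun j => if j ∈ varsOf (plusPart V S) then ξp j else ξm j)

/-- A call on `V` can make a recursive call on `W`. -/
def RecursiveCall (η : κ → ℝ) (lam : ℝ) (c : Node p κ → Node p κ → ℝ≥0∞) (u : Fin p → ℝ)
    (W V : Finset (Vertex p κ)) : Prop :=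
  ∃ γ f S, IsFlowStep η lam c u V γ f ∧ (∃ j ∈ varsOf V, f (varNode j) sink ≠ γ j) ∧
    IsMinCut (callGraph c V γ) source sink S ∧ (W = plusPart V S ∨ W = minusPart V S)

/-- `w` is a possible result of the algorithm on input `u` with initial graph `c`: the signs of the
negative entries of `u` are flipped, `computeFlow` is run on the whole graph, and `u - ξ̄` is
returned, with the signs of `ξ̄` flipped back. For `u ≥ 0` this is `w = u - ξ̄`. -/
def AlgorithmReturns (η : κ → ℝ) (lam : ℝ) (c : Node p κ → Node p κ → ℝ≥0∞) (u w : Fin p → ℝ) :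
    Prop :=
  ∃ ξ, ComputeFlow η lam c (fun j => |u j|) Finset.univ ξ ∧
    w = fun j => u j - (if u j < 0 then -ξ j else ξ j)

end Graphs

/-! ### The proximal operator -/

section Prox

variable {p : ℕ} {κ : Type*} [Fintype κ]

/-- `Ω(w) = ∑_g η_g ‖w_g‖_∞` (the norm of a function on a finite type is the sup norm). -/
noncomputable def Omega (grp : κ → Finset (Fin p)) (η : κ → ℝ) (w : Fin p → ℝ) : ℝ :=
  ∑ g, η g * ‖fun j : {j // j ∈ grp g} => w j‖

noncomputable def proxObjective (grp : κ → Finset (Fin p)) (η : κ → ℝ) (lam : ℝ)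
    (u w : Fin p → ℝ) : ℝ :=
  (1 / 2) * ∑ j, (u j - w j) ^ 2 + lam * Omega grp η w

/-- `w = Prox_{λΩ}(u)`: `w` is the unique minimizer of the proximal objective. -/
def IsProx (grp : κ → Finset (Fin p)) (η : κ → ℝ) (lam : ℝ) (u w : Fin p → ℝ) : Prop :=
  (∀ w', proxObjective grp η lam u w ≤ proxObjective grp η lam u w') ∧
  ∀ v, (∀ w', proxObjective grp η lam u v ≤ proxObjective grp η lam u w') → v = w

end Prox

/-! ### Max-flow min-cut with capacities in `ℝ≥0∞` -/

section NetworkTheory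

variable {N : Type*} [Fintype N]

/-! Let `F(J)` be the total capacity `λ η_g` of the groups meeting `J` (`coverWeight`). By the
layer-cake formula, `λ Ω(w)` is the integral over `t > 0` of `F({|w| ≥ t})`, and `∑ ξ_j |w_j|` is
the integral of `ξ({|w| ≥ t})`. If `ξ(J) ≤ F(J)` for all `J`, with equality on the level sets of the
residual `|u| - ξ`, then `∑ ξ_j |w_j|` is a lower bound for `λ Ω` that is attained at the residual.
Completing the square then shows that the residual, with the signs of `u` restored, is the unique
minimizer (`isProx_of_tight`).

It remains to show that `computeFlow` produces such a `ξ`. The property is localized to a set of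
groups and a set of variables (`IsTight`) and proved by induction on the recursion. At a leaf, `ξ`
is the soft-thresholded vector `γ` with threshold `τ`. It is feasible because a flow carries it
(`IsEquivalentGraph.flow_le_coverWeight`), and it is tight because either `τ = 0` or it uses all the
capacity.

At a split, arcs of infinite capacity cannot leave the source side of a minimum cut, so no group of
`V⁺` contains a variable of `V⁻`. The flow equals `γ` on `V⁺`, and on `V⁻` it uses the whole
capacity of the groups of `V⁻`. Hence `τ` separates the two recursive solutions: residuals are at
most `τ` on `V⁺`, and at least `τ` on `V⁻` wherever `u_j > τ` (`IsTight.residual_le`,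
`IsTight.le_residual`). Level sets above `τ` therefore lie in `V⁻`, while those at or below `τ`
already exhaust the groups of `V⁻`. This makes the two solutions glue (`IsTight.union`).

The same two facts about the cut give termination: if either side were all of `V`, the flow would
already equal `γ`. -/

theorem exists_isMaxFlow_of_finite {c : N → N → ℝ≥0∞} (hc : ∀ a b, c a b ≠ ⊤) (s t : N) :
    ∃ f, IsMaxFlow c s t f := by
  have hset : {f | IsFlow c s t f} = Set.Icc 0 (fun a b => (c a b).toReal) ∩
      ⋂ v, ⋂ (_ : v ≠ s), ⋂ (_ : v ≠ t), {f | ∑ a, f a v = ∑ b, f v b} := by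
    ext f
    simp only [Set.mem_ofPred_eq, Set.mem_inter_iff, Set.mem_Icc, Set.mem_iInter, Pi.le_def,
      Pi.zero_apply]
    constructor
    · intro h
      exact ⟨⟨h.nonneg, fun a b => (ENNReal.ofReal_le_iff_le_toReal (hc a b)).1 (h.le_cap a b)⟩,
        h.conserved⟩
    · rintro ⟨⟨h1, h2⟩, h3⟩
      exact ⟨h1, fun a b => (ENNReal.ofReal_le_iff_le_toReal (hc a b)).2 (h2 a b), h3⟩
  have hcomp : IsCompact {f | IsFlow c s t f} := by
    rw [hset]
    refine isCompact_Icc.inter_right ?_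
    refine isClosed_iInter fun v => isClosed_iInter fun _ => isClosed_iInter fun _ => ?_
    exact isClosed_eq (by fun_prop) (by fun_prop)
  have hne : {f | IsFlow c s t f}.Nonempty := ⟨fun _ _ => 0, by simp, by simp, by simp⟩
  obtain ⟨f, hf, hmax⟩ := hcomp.exists_isMaxOn hne
    (f := flowValue s) (by unfold flowValue; fun_prop)
  exact ⟨f, hf, fun f' hf' => hmax hf'⟩

variable [DecidableEq N]

theorem sum_net_outflow (f : N → N → ℝ) (T : Finset N) :
    ∑ a ∈ T, (∑ b, f a b - ∑ b, f b a) =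
      ∑ a ∈ T, ∑ b ∈ Tᶜ, f a b - ∑ a ∈ Tᶜ, ∑ b ∈ T, f a b := by
  have h1 : ∑ a ∈ T, ∑ b, f a b = ∑ a ∈ T, ∑ b ∈ T, f a b + ∑ a ∈ T, ∑ b ∈ Tᶜ, f a b := by
    rw [← Finset.sum_add_distrib]
    exact Finset.sum_congr rfl fun a _ => (Finset.sum_add_sum_compl T _).symm
  have h2 : ∑ a ∈ T, ∑ b, f b a = ∑ a ∈ T, ∑ b ∈ T, f a b + ∑ a ∈ Tᶜ, ∑ b ∈ T, f a b := by
    rw [Finset.sum_comm, Finset.sum_add_sum_compl T (fun a => ∑ b ∈ T, f a b)]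
  rw [Finset.sum_sub_distrib, h1, h2]
  ring

theorem IsFlow.inflow_eq_outflow {c : N → N → ℝ≥0∞} {s t : N} {f : N → N → ℝ}
    (hf : IsFlow c s t f) {T : Finset N} (hs : s ∉ T) (ht : t ∉ T) :
    ∑ a ∈ Tᶜ, ∑ b ∈ T, f a b = ∑ a ∈ T, ∑ b ∈ Tᶜ, f a b := by
  have h := sum_net_outflow f T
  rw [Finset.sum_eq_zero] at h
  · linarith
  · intro v hv
    rw [hf.conserved v (fun h => hs (h ▸ hv)) (fun h => ht (h ▸ hv)), sub_self]

theorem IsFlow.flowValue_eq {c : N → N → ℝ≥0∞} {s t : N} {f : N → N → ℝ}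
    (hf : IsFlow c s t f) {S : Finset N} (hs : s ∈ S) (ht : t ∉ S) :
    flowValue s f = ∑ a ∈ S, ∑ b ∈ Sᶜ, f a b - ∑ a ∈ Sᶜ, ∑ b ∈ S, f a b := by
  rw [← sum_net_outflow, Finset.sum_eq_single_of_mem s hs, flowValue]
  intro v hv hvs
  rw [hf.conserved v hvs (fun h => ht (h ▸ hv)), sub_self]

/-- A flow that saturates a cut and does not cross it backwards is maximum. -/
theorem IsFlow.isMaxFlow_of_saturated {c : N → N → ℝ≥0∞} {s t : N} {f : N → N → ℝ}
    (hf : IsFlow c s t f) {S : Finset N} (hs : s ∈ S) (ht : t ∉ S)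
    (hsat : ∀ a ∈ S, ∀ b ∉ S, ENNReal.ofReal (f a b) = c a b)
    (hback : ∀ a ∉ S, ∀ b ∈ S, f a b = 0) : IsMaxFlow c s t f := by
  refine ⟨hf, fun f' hf' => ?_⟩
  rw [hf.flowValue_eq hs ht, hf'.flowValue_eq hs ht]
  have h1 : ∑ a ∈ Sᶜ, ∑ b ∈ S, f a b = 0 :=
    Finset.sum_eq_zero fun a ha => Finset.sum_eq_zero fun b hb =>
      hback a (Finset.mem_compl.1 ha) b hb
  have h2 : 0 ≤ ∑ a ∈ Sᶜ, ∑ b ∈ S, f' a b :=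
    Finset.sum_nonneg fun a _ => Finset.sum_nonneg fun b _ => hf'.nonneg a b
  have h3 : ∑ a ∈ S, ∑ b ∈ Sᶜ, f' a b ≤ ∑ a ∈ S, ∑ b ∈ Sᶜ, f a b := by
    refine Finset.sum_le_sum fun a ha => Finset.sum_le_sum fun b hb => ?_
    rw [← ENNReal.ofReal_le_ofReal_iff (hf.nonneg a b), hsat a ha b (Finset.mem_compl.1 hb)]
    exact hf'.le_cap a b
  linarith

/-- The arcs of the residual graph of `f`. -/
def Residual (c : N → N → ℝ≥0∞) (f : N → N → ℝ) (a b : N) : Prop :=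
  ENNReal.ofReal (f a b) < c a b ∨ 0 < f b a

theorem sum_single_net (a b x : N) :
    ∑ y, (if x = a ∧ y = b then (1 : ℝ) else 0) - ∑ y, (if y = a ∧ x = b then (1 : ℝ) else 0) =
      (if x = a then 1 else 0) - (if x = b then 1 else 0) := by
  simp only [ite_and]
  congr 1
  · split_ifs <;> simp
  · rw [Finset.sum_ite_eq']
    simp

/-- A node that is reachable in the residual graph can be sent a unit from `s` along a feasible
direction at `f`. -/
theorem exists_feasible_direction {c : N → N → ℝ≥0∞} {f : N → N → ℝ} {s v : N}
    (h : Relation.ReflTransGen (Residual c f) s v) :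
    ∃ δ : N → N → ℝ, (∀ a b, f a b ≤ 0 → 0 ≤ δ a b) ∧
      (∀ a b, c a b ≤ ENNReal.ofReal (f a b) → δ a b ≤ 0) ∧
      ∀ x, ∑ b, δ x b - ∑ a, δ a x = (if x = s then 1 else 0) - (if x = v then 1 else 0) := by
  induction h with
  | refl => exact ⟨fun _ _ => 0, by simp, by simp, by simp⟩
  | @tail v w _ hvw ih =>
    obtain ⟨δ, h0, h1, h2⟩ := ih
    rcases hvw with hvw | hvw
    · refine ⟨fun a b => δ a b + if a = v ∧ b = w then 1 else 0, fun a b hab => ?_,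
        fun a b hab => ?_, fun x => ?_⟩
      · have := h0 a b hab
        dsimp only
        split_ifs <;> linarith
      · have := h1 a b hab
        dsimp only
        split_ifs with hh
        · obtain ⟨rfl, rfl⟩ := hh
          exact absurd hab (not_le.2 hvw)
        · linarith
      · have e := sum_single_net v w x
        have := h2 x
        simp only [Finset.sum_add_distrib]
        linarith
    · refine ⟨fun a b => δ a b - if a = w ∧ b = v then 1 else 0, fun a b hab => ?_,
        fun a b hab => ?_, fun x => ?_⟩
      · have := h0 a b hab
        dsimp only
        split_ifs with hh
        · obtain ⟨rfl, rfl⟩ := hh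
          exact absurd hab (not_le.2 hvw)
        · linarith
      · have := h1 a b hab
        dsimp only
        split_ifs <;> linarith
      · have e := sum_single_net w v x
        have := h2 x
        simp only [Finset.sum_sub_distrib]
        linarith

open Filter Topology in
theorem IsMaxFlow.not_reachable {c : N → N → ℝ≥0∞} {s t : N} {f : N → N → ℝ}
    (hf : IsMaxFlow c s t f) (hst : s ≠ t) : ¬ Relation.ReflTransGen (Residual c f) s t := by
  intro h
  obtain ⟨δ, h0, h1, h2⟩ := exists_feasible_direction h
  have lim : ∀ a b, Tendsto (fun ε : ℝ => f a b + ε * δ a b) (𝓝[>] 0) (𝓝 (f a b)) := by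
    intro a b
    have : Tendsto (fun ε : ℝ => f a b + ε * δ a b) (𝓝 0) (𝓝 (f a b + 0 * δ a b)) :=
      (Continuous.tendsto (by fun_prop) 0)
    rw [zero_mul, add_zero] at this
    exact this.mono_left nhdsWithin_le_nhds
  have pos : ∀ᶠ ε : ℝ in 𝓝[>] 0, 0 < ε := self_mem_nhdsWithin
  -- Where a bound is attained, the sign of `δ` protects it; where it is strict, continuity does, so
  -- no bottleneck capacity has to be computed.
  have e1 : ∀ᶠ ε : ℝ in 𝓝[>] 0, ∀ a b, 0 ≤ f a b + ε * δ a b := by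
    refine eventually_all.2 fun a => eventually_all.2 fun b => ?_
    rcases (hf.1.nonneg a b).eq_or_lt with hab | hab
    · filter_upwards [pos] with ε hε
      have := mul_nonneg hε.le (h0 a b hab.ge)
      linarith
    · exact ((lim a b).eventually (lt_mem_nhds hab)).mono fun _ h => h.le
  have e2 : ∀ᶠ ε : ℝ in 𝓝[>] 0, ∀ a b, ENNReal.ofReal (f a b + ε * δ a b) ≤ c a b := by
    refine eventually_all.2 fun a => eventually_all.2 fun b => ?_
    rcases (hf.1.le_cap a b).eq_or_lt with hab | hab
    · filter_upwards [pos] with ε hε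
      refine le_trans (ENNReal.ofReal_le_ofReal ?_) hab.le
      have := mul_nonpos_of_nonneg_of_nonpos hε.le (h1 a b hab.ge)
      linarith
    · have := (ENNReal.continuous_ofReal.tendsto (f a b)).comp (lim a b)
      exact (this.eventually (gt_mem_nhds hab)).mono fun _ h => h.le
  obtain ⟨ε, hε, h3, h4⟩ := (pos.and (e1.and e2)).exists
  have hflow : IsFlow c s t fun a b => f a b + ε * δ a b := by
    refine ⟨h3, h4, fun v hvs hvt => ?_⟩
    have := h2 v
    simp only [hvs, hvt, if_false, sub_zero] at this
    simp only [Finset.sum_add_distrib, ← Finset.mul_sum]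
    rw [hf.1.conserved v hvs hvt, sub_eq_zero.1 this]
  have hle := hf.2 _ hflow
  have := h2 s
  simp only [hst, if_true, if_false, sub_zero] at this
  simp only [flowValue, Finset.sum_add_distrib, ← Finset.mul_sum] at hle
  nlinarith

/-- Max-flow min-cut: a maximum flow saturates some cut. -/
theorem IsMaxFlow.exists_saturated_cut {c : N → N → ℝ≥0∞} {s t : N} {f : N → N → ℝ}
    (hf : IsMaxFlow c s t f) (hst : s ≠ t) :
    ∃ S : Finset N, s ∈ S ∧ t ∉ S ∧ (∀ a ∈ S, ∀ b ∉ S, ENNReal.ofReal (f a b) = c a b) ∧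
      ∀ a ∉ S, ∀ b ∈ S, f a b = 0 := by
  classical
  refine ⟨Finset.univ.filter fun v => Relation.ReflTransGen (Residual c f) s v, ?_, ?_, ?_, ?_⟩
  · simpa using Relation.ReflTransGen.refl
  · simpa using hf.not_reachable hst
  · intro a ha b hb
    simp only [Finset.mem_filter, Finset.mem_univ, true_and] at ha hb
    by_contra hne
    exact hb (ha.tail (Or.inl (lt_of_le_of_ne (hf.1.le_cap a b) hne)))
  · intro a ha b hb
    simp only [Finset.mem_filter, Finset.mem_univ, true_and] at ha hb
    by_contra hne
    exact ha (hb.tail (Or.inr (lt_of_le_of_ne (hf.1.nonneg a b) (Ne.symm hne))))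

theorem ofReal_sum_crossing {c : N → N → ℝ≥0∞} {s t : N} {f : N → N → ℝ}
    (hf : IsFlow c s t f) (S : Finset N) :
    ENNReal.ofReal (∑ a ∈ S, ∑ b ∈ Sᶜ, f a b) = ∑ a ∈ S, ∑ b ∈ Sᶜ, ENNReal.ofReal (f a b) := by
  rw [ENNReal.ofReal_sum_of_nonneg fun a _ => Finset.sum_nonneg fun b _ => hf.nonneg a b]
  exact Finset.sum_congr rfl fun a _ => ENNReal.ofReal_sum_of_nonneg fun b _ => hf.nonneg a b

/-- Every maximum flow saturates every minimum cut. -/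
theorem IsMaxFlow.saturates {c : N → N → ℝ≥0∞} {s t : N} {f : N → N → ℝ}
    (hf : IsMaxFlow c s t f) {S : Finset N} (hS : IsMinCut c s t S) :
    (∀ a ∈ S, ∀ b ∉ S, ENNReal.ofReal (f a b) = c a b) ∧ ∀ a ∉ S, ∀ b ∈ S, f a b = 0 := by
  obtain ⟨hs, ht, hmin⟩ := hS
  obtain ⟨S₀, hs₀, ht₀, hsat, hback⟩ := hf.exists_saturated_cut (fun h => ht (h ▸ hs))
  have hback0 : ∑ a ∈ S₀ᶜ, ∑ b ∈ S₀, f a b = 0 :=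
    Finset.sum_eq_zero fun a ha => Finset.sum_eq_zero fun b hb =>
      hback a (Finset.mem_compl.1 ha) b hb
  have hv0 := hf.1.flowValue_eq hs₀ ht₀
  rw [hback0, sub_zero] at hv0
  have hv := hf.1.flowValue_eq hs ht
  have hpos : 0 ≤ flowValue s f := by
    rw [hv0]
    exact Finset.sum_nonneg fun a _ => Finset.sum_nonneg fun b _ => hf.1.nonneg a b
  have hcap0 : cutCapacity c S₀ = ENNReal.ofReal (flowValue s f) := by
    rw [hv0, ofReal_sum_crossing hf.1, cutCapacity]
    exact Finset.sum_congr rfl fun a ha => Finset.sum_congr rfl fun b hb =>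
      (hsat a ha b (Finset.mem_compl.1 hb)).symm
  have hle : cutCapacity c S ≤ ENNReal.ofReal (flowValue s f) := hcap0 ▸ hmin S₀ hs₀ ht₀
  have hge : ENNReal.ofReal (∑ a ∈ S, ∑ b ∈ Sᶜ, f a b) ≤ cutCapacity c S := by
    rw [ofReal_sum_crossing hf.1]
    exact Finset.sum_le_sum fun a _ => Finset.sum_le_sum fun b _ => hf.1.le_cap a b
  -- The forward flow across `S` is at most the flow value, which is forward minus backward flow; so
  -- the backward flow vanishes.
  have hX := (ENNReal.ofReal_le_ofReal_iff hpos).1 (hge.trans hle)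
  have hY : 0 ≤ ∑ a ∈ Sᶜ, ∑ b ∈ S, f a b :=
    Finset.sum_nonneg fun a _ => Finset.sum_nonneg fun b _ => hf.1.nonneg a b
  have hY0 : ∑ a ∈ Sᶜ, ∑ b ∈ S, f a b = 0 := by linarith
  refine ⟨fun a ha b hb => ?_, fun a ha b hb => ?_⟩
  · have heq : cutCapacity c S = ∑ a ∈ S, ∑ b ∈ Sᶜ, ENNReal.ofReal (f a b) := by
      rw [← ofReal_sum_crossing hf.1]
      refine le_antisymm (hle.trans (ENNReal.ofReal_le_ofReal ?_)) hge
      linarith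
    refine le_antisymm (hf.1.le_cap a b) ?_
    by_contra! hlt
    have hmem : (a, b) ∈ S ×ˢ Sᶜ := Finset.mem_product.2 ⟨ha, Finset.mem_compl.2 hb⟩
    rw [cutCapacity, ← Finset.sum_product', ← Finset.sum_product',
      ← Finset.add_sum_erase _ _ hmem, ← Finset.add_sum_erase _ _ hmem] at heq
    refine absurd heq (ne_of_gt ?_)
    -- Strictness on one arc survives the addition because the remaining flow values have a finite
    -- sum.
    refine ENNReal.add_lt_add_of_lt_of_le ?_ hlt ?_
    · exact ENNReal.sum_ne_top.2 fun x _ => ENNReal.ofReal_ne_top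
    · exact Finset.sum_le_sum fun x _ => hf.1.le_cap x.1 x.2
  · exact (Finset.sum_eq_zero_iff_of_nonneg fun b _ => hf.1.nonneg a b).1
      ((Finset.sum_eq_zero_iff_of_nonneg fun a _ => Finset.sum_nonneg fun b _ =>
        hf.1.nonneg a b).1 hY0 a (Finset.mem_compl.2 ha)) b hb

theorem exists_isMinCut (c : N → N → ℝ≥0∞) {s t : N} (hst : s ≠ t) : ∃ S, IsMinCut c s t S := by
  obtain ⟨S, hS, hmin⟩ := Finset.exists_min_image
    (Finset.univ.filter fun S : Finset N => s ∈ S ∧ t ∉ S) (cutCapacity c)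
    ⟨{s}, by simpa using hst.symm⟩
  simp only [Finset.mem_filter, Finset.mem_univ, true_and] at hS hmin
  exact ⟨S, hS.1, hS.2, fun S' h1 h2 => hmin S' ⟨h1, h2⟩⟩

/-- Infinite capacities break compactness, so capacities are truncated at a level `M` above a finite
cut. A saturated cut of the truncated network carries less than `M` on every arc, so the truncation
is not felt there and the same cut certifies maximality in the original network. -/
theorem exists_isMaxFlow {c : N → N → ℝ≥0∞} {s t : N} {S₀ : Finset N} (hs₀ : s ∈ S₀)
    (ht₀ : t ∉ S₀) (hfin : cutCapacity c S₀ ≠ ⊤) : ∃ f, IsMaxFlow c s t f := by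
  set M := cutCapacity c S₀ + 1
  have hM : M ≠ ⊤ := ENNReal.add_ne_top.2 ⟨hfin, ENNReal.one_ne_top⟩
  have hlt : cutCapacity c S₀ < M := ENNReal.lt_add_right hfin one_ne_zero
  obtain ⟨f, hf⟩ := exists_isMaxFlow_of_finite (c := fun a b => min (c a b) M)
    (fun a b => ne_top_of_le_ne_top hM (min_le_right _ _)) s t
  obtain ⟨S, hs, ht, hsat, hback⟩ := hf.exists_saturated_cut (fun h => ht₀ (h ▸ hs₀))
  have hfc : IsFlow c s t f :=
    ⟨hf.1.nonneg, fun a b => (hf.1.le_cap a b).trans (min_le_left _ _), hf.1.conserved⟩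
  have hval : ENNReal.ofReal (flowValue s f) ≤ cutCapacity c S₀ := by
    rw [hfc.flowValue_eq hs₀ ht₀]
    have h0 : 0 ≤ ∑ a ∈ S₀ᶜ, ∑ b ∈ S₀, f a b :=
      Finset.sum_nonneg fun a _ => Finset.sum_nonneg fun b _ => hfc.nonneg a b
    refine (ENNReal.ofReal_le_ofReal (sub_le_self _ h0)).trans ?_
    rw [ofReal_sum_crossing hfc]
    exact Finset.sum_le_sum fun a _ => Finset.sum_le_sum fun b _ => hfc.le_cap a b
  refine ⟨f, hfc.isMaxFlow_of_saturated hs ht (fun a ha b hb => ?_) hback⟩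
  have hab := hsat a ha b hb
  have hle : f a b ≤ flowValue s f := by
    have h0 : ∑ a ∈ Sᶜ, ∑ b ∈ S, f a b = 0 :=
      Finset.sum_eq_zero fun a ha => Finset.sum_eq_zero fun b hb =>
        hback a (Finset.mem_compl.1 ha) b hb
    rw [hfc.flowValue_eq hs ht, h0, sub_zero]
    refine le_trans ?_ (Finset.single_le_sum (f := fun a => ∑ b ∈ Sᶜ, f a b)
      (fun a _ => Finset.sum_nonneg fun b _ => hfc.nonneg a b) ha)
    exact Finset.single_le_sum (f := fun b => f a b) (fun b _ => hfc.nonneg a b)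
      (Finset.mem_compl.2 hb)
  have hMlt : ENNReal.ofReal (f a b) < M :=
    ((ENNReal.ofReal_le_ofReal hle).trans hval).trans_lt hlt
  rcases min_choice (c a b) M with h | h
  · rw [hab, h]
  · rw [hab, h] at hMlt
    exact absurd hMlt (lt_irrefl _)

end NetworkTheory

/-! ### Soft thresholding and the projection onto the ℓ¹-ball -/

section Projection

variable {ι : Type*}

theorem exists_threshold (J : Finset ι) {u : ι → ℝ} (hu : ∀ j, 0 ≤ u j) {R : ℝ} (hR : 0 ≤ R) :
    ∃ τ, 0 ≤ τ ∧ ∑ j ∈ J, max (u j - τ) 0 ≤ R ∧ (τ = 0 ∨ ∑ j ∈ J, max (u j - τ) 0 = R) := by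
  by_cases h : ∑ j ∈ J, max (u j - 0) 0 ≤ R
  · exact ⟨0, le_rfl, h, Or.inl rfl⟩
  · have hcont : Continuous fun τ : ℝ => ∑ j ∈ J, max (u j - τ) 0 := by fun_prop
    have hM : 0 ≤ ∑ j ∈ J, u j := Finset.sum_nonneg fun j _ => hu j
    have hend : ∑ j ∈ J, max (u j - ∑ j ∈ J, u j) 0 = 0 :=
      Finset.sum_eq_zero fun j hj => max_eq_right
        (sub_nonpos.2 (Finset.single_le_sum (fun j _ => hu j) hj))
    obtain ⟨τ, hτ, hval⟩ := intermediate_value_Icc' hM hcont.continuousOn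
      (show R ∈ Set.Icc _ _ from ⟨hend.trans_le hR, (not_le.1 h).le⟩)
    exact ⟨τ, hτ.1, hval.le, Or.inr hval⟩

/-- Soft thresholding solves the projection onto the `ℓ¹`-ball, with quadratic growth. -/
theorem soft_threshold_optimal (J : Finset ι) {u : ι → ℝ} (hu : ∀ j, 0 ≤ u j) {R τ : ℝ}
    (hτ : 0 ≤ τ) (h : τ = 0 ∨ ∑ j ∈ J, max (u j - τ) 0 = R) {γ : ι → ℝ}
    (hγ : ∑ j ∈ J, |γ j| ≤ R) :
    ∑ j ∈ J, (1 / 2) * (u j - max (u j - τ) 0) ^ 2 +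
      ∑ j ∈ J, (1 / 2) * (γ j - max (u j - τ) 0) ^ 2 ≤ ∑ j ∈ J, (1 / 2) * (u j - γ j) ^ 2 := by
  -- `τ` acts as the Lagrange multiplier: the right-hand summand is `(u - m)(m - γ)` with `m = max
  -- (u - τ) 0`, and `u - m = min u τ`.
  have key : ∑ j ∈ J, τ * (max (u j - τ) 0 - |γ j|) ≤
      ∑ j ∈ J, ((1 / 2) * (u j - γ j) ^ 2 - (1 / 2) * (u j - max (u j - τ) 0) ^ 2 -
        (1 / 2) * (γ j - max (u j - τ) 0) ^ 2) := by
    refine Finset.sum_le_sum fun j _ => ?_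
    have h1 := le_abs_self (γ j)
    have h2 := hu j
    rcases le_total (u j - τ) 0 with h3 | h3
    · rw [max_eq_right h3]
      nlinarith [mul_nonneg (sub_nonneg.2 (sub_nonpos.1 h3)) (abs_nonneg (γ j)),
        mul_nonneg h2 (sub_nonneg.2 h1)]
    · rw [max_eq_left h3]
      nlinarith [mul_nonneg hτ (sub_nonneg.2 h1)]
  have hnn : 0 ≤ ∑ j ∈ J, τ * (max (u j - τ) 0 - |γ j|) := by
    rw [← Finset.mul_sum, Finset.sum_sub_distrib]
    rcases h with h | h
    · simp [h]
    · exact mul_nonneg hτ (by linarith)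
  rw [Finset.sum_sub_distrib, Finset.sum_sub_distrib] at key
  linarith

end Projection

/-! ### The projection step of a call -/

section ProjectionStep

variable {p : ℕ} {κ : Type*} [Fintype κ] [DecidableEq κ]

theorem exists_isProjectionStep {η : κ → ℝ} {lam : ℝ} {u : Fin p → ℝ} (hu : ∀ j, 0 ≤ u j)
    (V : Finset (Vertex p κ)) (hR : 0 ≤ lam * ∑ g ∈ grpsOf V, η g) :
    ∃ γ, IsProjectionStep η lam u V γ := by
  obtain ⟨τ, hτ, hle, hor⟩ := exists_threshold (varsOf V) hu hR
  refine ⟨fun j => max (u j - τ) 0, ?_, fun γ' hγ' => ?_⟩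
  · simpa only [abs_of_nonneg (le_max_right (_ : ℝ) 0)] using hle
  · have := soft_threshold_optimal (varsOf V) hu hτ hor hγ'
    have h0 : 0 ≤ ∑ j ∈ varsOf V, (1 / 2) * (γ' j - max (u j - τ) 0) ^ 2 :=
      Finset.sum_nonneg fun j _ => by positivity
    linarith

theorem IsProjectionStep.exists_threshold_eq {η : κ → ℝ} {lam : ℝ} {u : Fin p → ℝ}
    (hu : ∀ j, 0 ≤ u j) {V : Finset (Vertex p κ)} {γ : Fin p → ℝ}
    (h : IsProjectionStep η lam u V γ) :
    ∃ τ, 0 ≤ τ ∧ (∀ j ∈ varsOf V, γ j = max (u j - τ) 0) ∧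
      ∑ j ∈ varsOf V, γ j ≤ lam * ∑ g ∈ grpsOf V, η g ∧
      (τ = 0 ∨ ∑ j ∈ varsOf V, γ j = lam * ∑ g ∈ grpsOf V, η g) := by
  have hR : 0 ≤ lam * ∑ g ∈ grpsOf V, η g :=
    le_trans (Finset.sum_nonneg fun j _ => abs_nonneg _) h.1
  obtain ⟨τ, hτ, hle, hor⟩ := exists_threshold (varsOf V) hu hR
  have h1 := soft_threshold_optimal (varsOf V) hu hτ hor h.1
  have h2 := h.2 (fun j => max (u j - τ) 0)
    (by simpa only [abs_of_nonneg (le_max_right (_ : ℝ) 0)] using hle)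
  have hnn : ∀ j ∈ varsOf V, 0 ≤ (1 / 2) * (γ j - max (u j - τ) 0) ^ 2 :=
    fun j _ => by positivity
  -- Both vectors are minimizers, so quadratic growth forces their distance to be zero.
  have h0 : ∑ j ∈ varsOf V, (1 / 2) * (γ j - max (u j - τ) 0) ^ 2 = 0 :=
    le_antisymm (by linarith) (Finset.sum_nonneg hnn)
  have heq : ∀ j ∈ varsOf V, γ j = max (u j - τ) 0 := fun j hj => by
    have := (Finset.sum_eq_zero_iff_of_nonneg hnn).1 h0 j hj
    have h3 : (γ j - max (u j - τ) 0) ^ 2 = 0 := by linarith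
    exact sub_eq_zero.1 (pow_eq_zero_iff two_ne_zero |>.1 h3)
  rw [← Finset.sum_congr rfl heq] at hle hor
  exact ⟨τ, hτ, heq, hle, hor⟩

end ProjectionStep

/-! ### Integration over level sets -/

section LayerCake

theorem integral_level {x M : ℝ} (hx : 0 ≤ x) (hM : x ≤ M) :
    ∫ t in (0 : ℝ)..M, (if t ≤ x then (1 : ℝ) else 0) = x := by
  have := intervalIntegral.integral_indicator (μ := MeasureTheory.volume)
    (f := fun _ : ℝ => (1 : ℝ)) (show x ∈ Set.Icc 0 M from ⟨hx, hM⟩)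
  simpa [Set.indicator_apply] using this

theorem intervalIntegrable_level (x M : ℝ) :
    IntervalIntegrable (fun t : ℝ => if t ≤ x then (1 : ℝ) else 0) MeasureTheory.volume 0 M := by
  refine Antitone.intervalIntegrable fun s t hst => ?_
  split_ifs with h1 h2
  · exact le_rfl
  · exact absurd (hst.trans h1) h2
  · exact zero_le_one
  · exact le_rfl

theorem intervalIntegrable_sum_levels {ι : Type*} (s : Finset ι) (a x : ι → ℝ) (M : ℝ) :
    IntervalIntegrable (fun t : ℝ => ∑ i ∈ s, a i * if t ≤ x i then (1 : ℝ) else 0)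
      MeasureTheory.volume 0 M := by
  have := IntervalIntegrable.sum s (f := fun i t => a i * if t ≤ x i then (1 : ℝ) else 0)
    fun i _ => (intervalIntegrable_level (x i) M).const_mul (a i)
  rwa [Finset.sum_fn] at this

/-- Layer-cake formula for a weighted finite sum. -/
theorem integral_sum_levels {ι : Type*} (s : Finset ι) (a x : ι → ℝ) {M : ℝ}
    (hx : ∀ i ∈ s, 0 ≤ x i) (hM : ∀ i ∈ s, x i ≤ M) :
    ∫ t in (0 : ℝ)..M, ∑ i ∈ s, a i * (if t ≤ x i then (1 : ℝ) else 0) = ∑ i ∈ s, a i * x i := by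
  rw [intervalIntegral.integral_finsetSum fun i _ =>
    (intervalIntegrable_level (x i) M).const_mul (a i)]
  refine Finset.sum_congr rfl fun i hi => ?_
  rw [intervalIntegral.integral_const_mul, integral_level (hx i hi) (hM i hi)]

end LayerCake

/-! ### Optimality criterion for the proximal operator -/

section ProxCriterion

variable {p : ℕ} {κ : Type*}

/-- The total capacity of the groups of `H` that meet `J`. -/
def coverWeight (grp : κ → Finset (Fin p)) (η : κ → ℝ) (lam : ℝ) (H : Finset κ)
    (J : Finset (Fin p)) : ℝ :=
  ∑ g ∈ H.filter (fun g => ∃ j ∈ J, j ∈ grp g), lam * η g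

variable [Fintype κ] {grp : κ → Finset (Fin p)} {η : κ → ℝ} {lam : ℝ}

theorem le_norm_restrict_iff (w : Fin p → ℝ) (s : Finset (Fin p)) {t : ℝ} (ht : 0 < t) :
    t ≤ ‖fun j : {j // j ∈ s} => w j‖ ↔
      ∃ j ∈ Finset.univ.filter (fun j => t ≤ |w j|), j ∈ s := by
  rw [← not_lt, pi_norm_lt_iff ht]
  simp [and_comm]

/-- For `t > 0` a group has norm at least `t` exactly when it meets the level set `{|w| ≥ t}`, so
the layers of `λ Ω` are values of `coverWeight`. Inequalities between set functions on level sets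
thereby become inequalities between `∑ ξ_j |w_j|` and `λ Ω(w)`. -/
theorem exists_layers (grp : κ → Finset (Fin p)) (η : κ → ℝ) (lam : ℝ) (ξ w : Fin p → ℝ) :
    ∃ M : ℝ, 0 ≤ M ∧ ∃ F G : ℝ → ℝ,
      IntervalIntegrable F MeasureTheory.volume 0 M ∧
      IntervalIntegrable G MeasureTheory.volume 0 M ∧
      ∫ t in (0 : ℝ)..M, F t = ∑ j, ξ j * |w j| ∧
      ∫ t in (0 : ℝ)..M, G t = lam * Omega grp η w ∧
      ∀ t, 0 < t → F t = ∑ j with t ≤ |w j|, ξ j ∧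
        G t = coverWeight grp η lam Finset.univ (Finset.univ.filter fun j => t ≤ |w j|) := by
  have hM : ∀ s : Finset (Fin p), ‖fun j : {j // j ∈ s} => w j‖ ≤ ‖w‖ := fun s =>
    (pi_norm_le_iff_of_nonneg (norm_nonneg w)).2 fun j => norm_le_pi_norm w j
  refine ⟨‖w‖, norm_nonneg w, _, _, intervalIntegrable_sum_levels Finset.univ ξ (fun j => |w j|) _,
    intervalIntegrable_sum_levels Finset.univ (fun g => lam * η g)
      (fun g => ‖fun j : {j // j ∈ grp g} => w j‖) _,
    integral_sum_levels _ _ _ (fun j _ => abs_nonneg _) (fun j _ => norm_le_pi_norm w j), ?_, ?_⟩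
  · rw [integral_sum_levels _ _ _ (fun j _ => norm_nonneg _) (fun g _ => hM _), Omega,
      Finset.mul_sum]
    exact Finset.sum_congr rfl fun g _ => mul_assoc _ _ _
  · intro t ht
    constructor
    · simp [Finset.sum_filter]
    · simp only [le_norm_restrict_iff w _ ht, coverWeight]
      simp [Finset.sum_filter]

theorem sum_mul_abs_le_Omega {ξ : Fin p → ℝ}
    (hξ : ∀ J, ∑ j ∈ J, ξ j ≤ coverWeight grp η lam Finset.univ J) (w : Fin p → ℝ) :
    ∑ j, ξ j * |w j| ≤ lam * Omega grp η w := by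
  obtain ⟨M, hM, F, G, hF, hG, iF, iG, h⟩ := exists_layers grp η lam ξ w
  rw [← iF, ← iG]
  refine intervalIntegral.integral_mono_on_of_le_Ioo hM hF hG fun t ht => ?_
  rw [(h t ht.1).1, (h t ht.1).2]
  exact hξ _

theorem Omega_le_sum_mul_abs {ξ w : Fin p → ℝ}
    (hw : ∀ t, 0 < t → coverWeight grp η lam Finset.univ (Finset.univ.filter fun j => t ≤ |w j|) ≤
      ∑ j with t ≤ |w j|, ξ j) :
    lam * Omega grp η w ≤ ∑ j, ξ j * |w j| := by
  obtain ⟨M, hM, F, G, hF, hG, iF, iG, h⟩ := exists_layers grp η lam ξ w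
  rw [← iF, ← iG]
  refine intervalIntegral.integral_mono_on_of_le_Ioo hM hG hF fun t ht => ?_
  rw [(h t ht.1).1, (h t ht.1).2]
  exact hw t ht.1

/-- Optimality criterion: `ξ` lies in the polymatroid of `coverWeight` and is tight on the level
sets of the residual `|u| - ξ`. -/
theorem isProx_of_tight {u ξ : Fin p → ℝ} (h0 : ∀ j, 0 ≤ ξ j) (h1 : ∀ j, ξ j ≤ |u j|)
    (hξ : ∀ J, ∑ j ∈ J, ξ j ≤ coverWeight grp η lam Finset.univ J)
    (hw : ∀ t, 0 < t →
      coverWeight grp η lam Finset.univ (Finset.univ.filter fun j => t ≤ |u j| - ξ j) ≤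
        ∑ j with t ≤ |u j| - ξ j, ξ j) :
    IsProx grp η lam u (fun j => u j - (if u j < 0 then -ξ j else ξ j)) := by
  set w : Fin p → ℝ := fun j => u j - (if u j < 0 then -ξ j else ξ j) with hwdef
  have habs : ∀ j, |w j| = |u j| - ξ j := by
    intro j
    have a := h0 j
    have b := h1 j
    simp only [hwdef]
    split_ifs with h
    · rw [abs_of_neg h] at b ⊢
      rw [abs_of_nonpos (by linarith)]
      ring
    · rw [abs_of_nonneg (not_lt.1 h)] at b ⊢
      rw [abs_of_nonneg (by linarith)]
  have hle : lam * Omega grp η w ≤ ∑ j, ξ j * |w j| :=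
    Omega_le_sum_mul_abs fun t ht => by simpa only [habs] using hw t ht
  have key : ∀ w', proxObjective grp η lam u w + (1 / 2) * ∑ j, (w' j - w j) ^ 2 ≤
      proxObjective grp η lam u w' := by
    intro w'
    have hge := sum_mul_abs_le_Omega hξ w'
    -- Coordinatewise, expanding the square around `w` leaves the cross term `ξ_j (±w'_j)` against
    -- `ξ_j |w'_j|`, the sign being that of `u_j`.
    have hsum : (1 / 2) * ∑ j, (u j - w j) ^ 2 + ∑ j, ξ j * |w j| +
        (1 / 2) * ∑ j, (w' j - w j) ^ 2 ≤ (1 / 2) * ∑ j, (u j - w' j) ^ 2 + ∑ j, ξ j * |w' j| := by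
      rw [Finset.mul_sum, Finset.mul_sum, Finset.mul_sum, ← Finset.sum_add_distrib,
        ← Finset.sum_add_distrib, ← Finset.sum_add_distrib]
      refine Finset.sum_le_sum fun j _ => ?_
      rw [habs]
      have a := h0 j
      simp only [hwdef]
      split_ifs with h
      · rw [abs_of_neg h]
        nlinarith [mul_le_mul_of_nonneg_left (neg_le_abs (w' j)) a]
      · rw [abs_of_nonneg (not_lt.1 h)]
        nlinarith [mul_le_mul_of_nonneg_left (le_abs_self (w' j)) a]
    unfold proxObjective
    linarith
  refine ⟨fun w' => ?_, fun v hv => ?_⟩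
  · have h2 : 0 ≤ (1 / 2) * ∑ j, (w' j - w j) ^ 2 := by positivity
    linarith [key w']
  · have h2 := key v
    have h3 := hv w
    have h4 : ∑ j, (v j - w j) ^ 2 = 0 :=
      le_antisymm (by linarith) (Finset.sum_nonneg fun j _ => sq_nonneg _)
    funext j
    have h5 := (Finset.sum_eq_zero_iff_of_nonneg fun j _ => sq_nonneg (v j - w j)).1 h4 j
      (Finset.mem_univ j)
    exact sub_eq_zero.1 (pow_eq_zero_iff two_ne_zero |>.1 h5)

end ProxCriterion

/-! ### Reachability and simple paths -/

section Reachability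

theorem exists_nodup_chain {α : Type*} {r : α → α → Prop} {a b : α}
    (h : Relation.ReflTransGen r a b) :
    ∃ l : List α, l.Nodup ∧ l.head? = some a ∧ l.getLast? = some b ∧ l.IsChain r := by
  induction h using Relation.ReflTransGen.head_induction_on with
  | refl => exact ⟨[b], by simp⟩
  | @head a m ham _ ih =>
    obtain ⟨l, h1, h2, h3, h4⟩ := ih
    -- If `a` is already on the path, the loop is cut out by keeping only the part from `a` on.
    by_cases hal : a ∈ l
    · obtain ⟨l₁, l₂, rfl⟩ := List.append_of_mem hal
      refine ⟨a :: l₂, h1.of_append_right, rfl, ?_, h4.right_of_append⟩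
      rwa [List.getLast?_append_of_ne_nil _ (List.cons_ne_nil a l₂)] at h3
    · refine ⟨a :: l, List.nodup_cons.2 ⟨hal, h1⟩, rfl, ?_, ?_⟩
      · rw [List.getLast?_cons, h3]
        rfl
      · rw [List.isChain_cons]
        refine ⟨fun y hy => ?_, h4⟩
        rw [h2] at hy
        obtain rfl := Option.some.inj hy
        exact ham

theorem reflTransGen_of_isChain {α : Type*} {r : α → α → Prop} {a b : α} {l : List α}
    (h1 : l.head? = some a) (h2 : l.getLast? = some b) (h3 : l.IsChain r) :
    Relation.ReflTransGen r a b := by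
  induction l generalizing a with
  | nil => simp at h1
  | cons x l ih =>
    obtain rfl : x = a := by simpa using h1
    cases l with
    | nil =>
      obtain rfl : x = b := by simpa using h2
      exact .refl
    | cons y l =>
      rw [List.isChain_cons_cons] at h3
      exact .head h3.1 (ih rfl (by simpa using h2) h3.2)

end Reachability

/-! ### Graphs equivalent to the canonical one, and their cuts -/

section Graphs

variable {p : ℕ} {κ : Type*} {grp : κ → Finset (Fin p)} {η : κ → ℝ} {lam : ℝ}

theorem canonical_isDirPath {g : κ} {j : Fin p} {l : List (Node p κ)}
    (h1 : l.head? = some (grpNode g)) (h2 : l.getLast? = some (varNode j))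
    (h3 : l.IsChain fun x y => 0 < canonicalGraph grp η lam x y) :
    l = [grpNode g, varNode j] ∧ j ∈ grp g := by
  match l, h1, h2, h3 with
  | [x], h1, h2, _ => simp_all
  | [x, y], h1, h2, h3 =>
    obtain rfl : x = grpNode g := by simpa using h1
    obtain rfl : y = varNode j := by simpa using h2
    refine ⟨rfl, ?_⟩
    by_contra hj
    simp [canonicalGraph, hj] at h3
  | x :: y :: z :: l, h1, h2, h3 =>
    exfalso
    obtain rfl : x = grpNode g := by simpa using h1
    rw [List.isChain_cons_cons, List.isChain_cons_cons] at h3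
    obtain ⟨hxy, hyz, hl⟩ := h3
    rcases y with (_ | _) | (k | g') <;> simp [canonicalGraph] at hxy
    rcases z with (_ | _) | (k' | g') <;> simp [canonicalGraph] at hyz
    cases l with
    | nil => simp at h2
    | cons y l =>
      rw [List.isChain_cons_cons] at hl
      simp [canonicalGraph] at hl

theorem canonicalGraph_isEquivalentGraph (grp : κ → Finset (Fin p)) (η : κ → ℝ) (lam : ℝ) :
    IsEquivalentGraph grp η lam (canonicalGraph grp η lam) where
  into_source v := by rcases v with (_ | _) | (_ | _) <;> rfl
  out_of_sink v := by rcases v with (_ | _) | (_ | _) <;> rfl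
  out_of_source _ := rfl
  into_sink _ := rfl
  path_of_mem g j hj := by
    refine ⟨[grpNode g, varNode j], ⟨⟨?_, rfl, rfl, ?_⟩, ?_⟩, ?_⟩
    · simp
    · simp [canonicalGraph, hj]
    · simp [canonicalGraph, hj]
    · rintro l ⟨⟨_, h1, h2, h3⟩, _⟩
      exact (canonical_isDirPath h1 h2 h3).1
  mem_of_path _ _ _ h := (canonical_isDirPath h.2.1 h.2.2.1 h.2.2.2).2

variable {c : Node p κ → Node p κ → ℝ≥0∞}

theorem IsEquivalentGraph.mem_of_reachable (hc : IsEquivalentGraph grp η lam c) {g : κ} {j : Fin p}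
    (h : Relation.ReflTransGen (fun a b => 0 < c a b) (grpNode g) (varNode j)) : j ∈ grp g := by
  obtain ⟨l, hl⟩ := exists_nodup_chain h
  exact hc.mem_of_path g j l hl

/-- Inside `V`, every group reaches its variables through arcs of infinite capacity. -/
def InfinitelyConnected (grp : κ → Finset (Fin p)) (c : Node p κ → Node p κ → ℝ≥0∞)
    (V : Finset (Vertex p κ)) : Prop :=
  ∀ g j, Sum.inr g ∈ V → Sum.inl j ∈ V → j ∈ grp g →
    Relation.ReflTransGen (fun v w : Vertex p κ => v ∈ V ∧ w ∈ V ∧ c (Sum.inr v) (Sum.inr w) = ⊤)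
      (Sum.inr g) (Sum.inl j)

theorem IsEquivalentGraph.infinitelyConnected_univ [Fintype κ]
    (hc : IsEquivalentGraph grp η lam c) : InfinitelyConnected grp c Finset.univ := by
  intro g j _ _ hj
  obtain ⟨l, ⟨⟨_, h1, h2, _⟩, h3⟩, _⟩ := hc.path_of_mem g j hj
  suffices H : ∀ a : Node p κ, Relation.ReflTransGen (fun x y => c x y = ⊤) a (varNode j) →
      a = sink ∨ a = source ∨ ∃ v, a = Sum.inr v ∧
        Relation.ReflTransGen (fun v w : Vertex p κ => v ∈ Finset.univ ∧ w ∈ Finset.univ ∧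
          c (Sum.inr v) (Sum.inr w) = ⊤) v (Sum.inl j) by
    rcases H _ (reflTransGen_of_isChain h1 h2 h3) with h | h | ⟨v, hv, h⟩
    · simp at h
    · simp at h
    · obtain rfl := Sum.inr.inj hv
      exact h
  intro a ha
  induction ha using Relation.ReflTransGen.head_induction_on with
  | refl => exact Or.inr (Or.inr ⟨_, rfl, .refl⟩)
  | @head a b hab hb ih =>
    rcases a with (_ | _) | v
    · exact Or.inr (Or.inl rfl)
    · exact Or.inl rfl
    · refine Or.inr (Or.inr ⟨v, rfl, ?_⟩)
      -- The walk cannot pass through the terminals: no arc leaves the sink or enters the source.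
      rcases ih with rfl | rfl | ⟨w, rfl, hw⟩
      · exfalso
        rcases Relation.ReflTransGen.cases_head hb with h | ⟨x, hx, _⟩
        · simp at h
        · simp [hc.out_of_sink] at hx
      · simp [hc.into_source] at hab
      · exact .head ⟨Finset.mem_univ _, Finset.mem_univ _, hab⟩ hw

theorem callGraph_inner {V : Finset (Vertex p κ)} {γ : Fin p → ℝ} {v w : Vertex p κ} (hv : v ∈ V)
    (hw : w ∈ V) : callGraph c V γ (Sum.inr v) (Sum.inr w) = c (Sum.inr v) (Sum.inr w) := by
  rcases v with v | v <;> simp [callGraph, InCall, setSinkCapacity, hv, hw]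

theorem callGraph_of_notMem_left {V : Finset (Vertex p κ)} {γ : Fin p → ℝ} {v : Vertex p κ}
    (hv : v ∉ V) (b : Node p κ) : callGraph c V γ (Sum.inr v) b = 0 := by
  simp [callGraph, InCall, hv]

theorem callGraph_of_notMem_right {V : Finset (Vertex p κ)} {γ : Fin p → ℝ} {v : Vertex p κ}
    (hv : v ∉ V) (a : Node p κ) : callGraph c V γ a (Sum.inr v) = 0 := by
  simp [callGraph, InCall, hv]

theorem callGraph_var_sink {V : Finset (Vertex p κ)} {γ : Fin p → ℝ} {j : Fin p}
    (hj : Sum.inl j ∈ V) : callGraph c V γ (varNode j) sink = ENNReal.ofReal (γ j) := by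
  simp [callGraph, InCall, setSinkCapacity, hj]

theorem IsEquivalentGraph.callGraph_source_grp (hc : IsEquivalentGraph grp η lam c)
    {V : Finset (Vertex p κ)} {γ : Fin p → ℝ} {g : κ} (hg : Sum.inr g ∈ V) :
    callGraph c V γ source (grpNode g) = ENNReal.ofReal (lam * η g) := by
  simp [callGraph, InCall, setSinkCapacity, hg, hc.out_of_source, canonicalGraph]

theorem IsEquivalentGraph.callGraph_source_var (hc : IsEquivalentGraph grp η lam c)
    (V : Finset (Vertex p κ)) (γ : Fin p → ℝ) (j : Fin p) :
    callGraph c V γ source (varNode j) = 0 := by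
  simp [callGraph, setSinkCapacity, hc.out_of_source, canonicalGraph]

theorem IsEquivalentGraph.callGraph_grp_sink (hc : IsEquivalentGraph grp η lam c)
    (V : Finset (Vertex p κ)) (γ : Fin p → ℝ) (g : κ) :
    callGraph c V γ (grpNode g) sink = 0 := by
  simp [callGraph, setSinkCapacity, hc.into_sink, canonicalGraph]

theorem IsEquivalentGraph.callGraph_into_source (hc : IsEquivalentGraph grp η lam c)
    (V : Finset (Vertex p κ)) (γ : Fin p → ℝ) (a : Node p κ) :
    callGraph c V γ a source = 0 := by
  rcases a with (_ | _) | (_ | _) <;> simp [callGraph, setSinkCapacity, hc.into_source]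

theorem IsEquivalentGraph.callGraph_out_of_sink (hc : IsEquivalentGraph grp η lam c)
    (V : Finset (Vertex p κ)) (γ : Fin p → ℝ) (a : Node p κ) :
    callGraph c V γ sink a = 0 := by
  simp [callGraph, setSinkCapacity, hc.out_of_sink]

theorem IsEquivalentGraph.callGraph_source_sink (hc : IsEquivalentGraph grp η lam c)
    (V : Finset (Vertex p κ)) (γ : Fin p → ℝ) : callGraph c V γ source sink = 0 := by
  simp [callGraph, setSinkCapacity, hc.into_sink, canonicalGraph]

variable [DecidableEq κ]

theorem mem_varsOf {V : Finset (Vertex p κ)} {j : Fin p} : j ∈ varsOf V ↔ Sum.inl j ∈ V := by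
  simp [varsOf]

theorem mem_plusPart {V : Finset (Vertex p κ)} {S : Finset (Node p κ)} {v : Vertex p κ} :
    v ∈ plusPart V S ↔ v ∈ V ∧ Sum.inr v ∈ S := by
  simp [plusPart]

theorem mem_minusPart {V : Finset (Vertex p κ)} {S : Finset (Node p κ)} {v : Vertex p κ} :
    v ∈ minusPart V S ↔ v ∈ V ∧ Sum.inr v ∉ S := by
  simp [minusPart]

theorem varsOf_plus_union_minus (V : Finset (Vertex p κ)) (S : Finset (Node p κ)) :
    varsOf (plusPart V S) ∪ varsOf (minusPart V S) = varsOf V := by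
  ext j
  simp only [Finset.mem_union, mem_varsOf, mem_plusPart, mem_minusPart]
  tauto

variable [Fintype κ]

theorem mem_grpsOf {V : Finset (Vertex p κ)} {g : κ} : g ∈ grpsOf V ↔ Sum.inr g ∈ V := by
  simp [grpsOf]

theorem sum_vertices (W : Finset (Vertex p κ)) (F : Vertex p κ → ℝ) :
    ∑ v ∈ W, F v = ∑ j ∈ varsOf W, F (Sum.inl j) + ∑ g ∈ grpsOf W, F (Sum.inr g) := by
  have h : ∑ v ∈ W, F v = ∑ v, if v ∈ W then F v else 0 := by simp
  rw [h, Fintype.sum_sum_type, varsOf, grpsOf, Finset.sum_filter, Finset.sum_filter]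

theorem grpsOf_plus_union_minus (V : Finset (Vertex p κ)) (S : Finset (Node p κ)) :
    grpsOf (plusPart V S) ∪ grpsOf (minusPart V S) = grpsOf V := by
  ext j
  simp only [Finset.mem_union, mem_grpsOf, mem_plusPart, mem_minusPart]
  tauto

theorem IsFlow.eq_zero {N : Type*} [Fintype N] {c : N → N → ℝ≥0∞} {s t : N} {f : N → N → ℝ}
    (hf : IsFlow c s t f) {a b : N} (h : c a b = 0) : f a b = 0 :=
  le_antisymm (ENNReal.ofReal_eq_zero.1 (le_antisymm (h ▸ hf.le_cap a b) zero_le))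
    (hf.nonneg a b)

/-- Only the finite arcs `(s,g)` leave the source. This gives existence of maximum flows and
finiteness of minimum cuts. -/
theorem IsEquivalentGraph.cutCapacity_source_ne_top (hc : IsEquivalentGraph grp η lam c)
    (V : Finset (Vertex p κ)) (γ : Fin p → ℝ) :
    cutCapacity (callGraph c V γ) {source} ≠ ⊤ := by
  rw [cutCapacity, Finset.sum_singleton]
  refine ENNReal.sum_ne_top.2 fun b hb => ?_
  rcases b with (_ | _) | (j | g)
  · rw [hc.callGraph_into_source]
    exact ENNReal.zero_ne_top
  · rw [hc.callGraph_source_sink]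
    exact ENNReal.zero_ne_top
  · rw [hc.callGraph_source_var]
    exact ENNReal.zero_ne_top
  · by_cases hg : Sum.inr g ∈ V
    · rw [hc.callGraph_source_grp hg]
      exact ENNReal.ofReal_ne_top
    · rw [callGraph_of_notMem_right hg]
      exact ENNReal.zero_ne_top

/-- Arcs of infinite capacity inside `V` do not leave the source side of a minimum cut. -/
theorem IsEquivalentGraph.mem_of_arc_eq_top (hc : IsEquivalentGraph grp η lam c)
    {V : Finset (Vertex p κ)} {γ : Fin p → ℝ} {S : Finset (Node p κ)}
    (hS : IsMinCut (callGraph c V γ) source sink S) {v w : Vertex p κ} (hv : v ∈ V) (hw : w ∈ V)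
    (hvw : c (Sum.inr v) (Sum.inr w) = ⊤) (hvS : Sum.inr v ∈ S) : Sum.inr w ∈ S := by
  by_contra hwS
  have h1 : cutCapacity (callGraph c V γ) S ≠ ⊤ :=
    ne_top_of_le_ne_top (hc.cutCapacity_source_ne_top V γ)
      (hS.2.2 {source} (by simp) (by simp))
  have h2 := ENNReal.sum_ne_top.1 (ENNReal.sum_ne_top.1 h1 _ hvS) _ (Finset.mem_compl.2 hwS)
  rw [callGraph_inner hv hw] at h2
  exact h2 hvw

theorem IsEquivalentGraph.group_subset_plus (hc : IsEquivalentGraph grp η lam c)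
    {V : Finset (Vertex p κ)} {γ : Fin p → ℝ} {S : Finset (Node p κ)}
    (hS : IsMinCut (callGraph c V γ) source sink S) (hV : InfinitelyConnected grp c V)
    {g : κ} {j : Fin p} (hg : Sum.inr g ∈ plusPart V S) (hj : Sum.inl j ∈ V) (hjg : j ∈ grp g) :
    Sum.inl j ∈ plusPart V S := by
  rw [mem_plusPart] at hg ⊢
  refine ⟨hj, ?_⟩
  have h := hV g j hg.1 hj hjg
  generalize (Sum.inl j : Vertex p κ) = v at h
  induction h with
  | refl => exact hg.2
  | tail _ hvw ih => exact hc.mem_of_arc_eq_top hS hvw.1 hvw.2.1 hvw.2.2 ih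

/-- Walks of infinite arcs that start on the source side never leave it, so the invariant passes to
the recursive call. -/
theorem IsEquivalentGraph.infinitelyConnected_plus (hc : IsEquivalentGraph grp η lam c)
    {V : Finset (Vertex p κ)} {γ : Fin p → ℝ} {S : Finset (Node p κ)}
    (hS : IsMinCut (callGraph c V γ) source sink S) (hV : InfinitelyConnected grp c V) :
    InfinitelyConnected grp c (plusPart V S) := by
  intro g j hg hj hjg
  have h := hV g j (mem_plusPart.1 hg).1 (mem_plusPart.1 hj).1 hjg
  suffices H : ∀ v : Vertex p κ, Relation.ReflTransGen
      (fun v w => v ∈ V ∧ w ∈ V ∧ c (Sum.inr v) (Sum.inr w) = ⊤) (Sum.inr g) v →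
      v ∈ plusPart V S ∧ Relation.ReflTransGen (fun v w : Vertex p κ => v ∈ plusPart V S ∧
        w ∈ plusPart V S ∧ c (Sum.inr v) (Sum.inr w) = ⊤) (Sum.inr g) v from (H _ h).2
  intro v hv
  induction hv with
  | refl => exact ⟨hg, .refl⟩
  | tail _ hvw ih =>
    have hw := mem_plusPart.2 ⟨hvw.2.1,
      hc.mem_of_arc_eq_top hS hvw.1 hvw.2.1 hvw.2.2 (mem_plusPart.1 ih.1).2⟩
    exact ⟨hw, ih.2.tail ⟨ih.1, hw, hvw.2.2⟩⟩

/-- The same closure read backwards: a walk of infinite arcs ending on the sink side was there from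
its start. -/
theorem IsEquivalentGraph.infinitelyConnected_minus (hc : IsEquivalentGraph grp η lam c)
    {V : Finset (Vertex p κ)} {γ : Fin p → ℝ} {S : Finset (Node p κ)}
    (hS : IsMinCut (callGraph c V γ) source sink S) (hV : InfinitelyConnected grp c V) :
    InfinitelyConnected grp c (minusPart V S) := by
  intro g j hg hj hjg
  have h := hV g j (mem_minusPart.1 hg).1 (mem_minusPart.1 hj).1 hjg
  suffices H : ∀ v : Vertex p κ, Relation.ReflTransGen
      (fun v w => v ∈ V ∧ w ∈ V ∧ c (Sum.inr v) (Sum.inr w) = ⊤) v (Sum.inl j) →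
      v ∈ minusPart V S ∧ Relation.ReflTransGen (fun v w : Vertex p κ => v ∈ minusPart V S ∧
        w ∈ minusPart V S ∧ c (Sum.inr v) (Sum.inr w) = ⊤) v (Sum.inl j) from (H _ h).2
  intro v hv
  induction hv using Relation.ReflTransGen.head_induction_on with
  | refl => exact ⟨hj, .refl⟩
  | head hvw _ ih =>
    have hw := mem_minusPart.2 ⟨hvw.1, fun hvS => (mem_minusPart.1 ih.1).2
      (hc.mem_of_arc_eq_top hS hvw.1 hvw.2.1 hvw.2.2 hvS)⟩
    exact ⟨hw, .head ⟨hw, ih.1, hvw.2.2⟩ ih.2⟩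

/-- The flow into the sink from a set `J` of variables is bounded by the capacity of the groups that
meet `J`, within any part `U` of `V` that receives no flow from the rest of `V`. -/
theorem IsEquivalentGraph.flow_le_coverWeight (hc : IsEquivalentGraph grp η lam c)
    (hη : ∀ g, 0 ≤ lam * η g) {V U : Finset (Vertex p κ)} {γ : Fin p → ℝ}
    {f : Node p κ → Node p κ → ℝ} (hf : IsFlow (callGraph c V γ) source sink f) (hUV : U ⊆ V)
    (hback : ∀ v ∈ V, v ∉ U → ∀ w ∈ U, f (Sum.inr v) (Sum.inr w) = 0) {J : Finset (Fin p)}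
    (hJ : J ⊆ varsOf U) :
    ∑ j ∈ J, f (varNode j) sink ≤ coverWeight grp η lam (grpsOf U) J := by
  classical
  -- `T₀` contains `J` and is closed under predecessors within `U`, so flow enters it only from the
  -- source, through groups that reach `J` and hence meet it.
  set T₀ : Finset (Vertex p κ) := U.filter fun v => ∃ j ∈ J,
    Relation.ReflTransGen (fun a b => 0 < c a b) (Sum.inr v) (varNode j) with hT₀
  set T : Finset (Node p κ) := T₀.map Function.Embedding.inr with hT
  have hs : source ∉ T := by simp [hT]
  have ht : sink ∉ T := by simp [hT]
  have hbal := hf.inflow_eq_outflow hs ht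
  have hout : ∑ j ∈ J, f (varNode j) sink ≤ ∑ a ∈ T, ∑ b ∈ Tᶜ, f a b := by
    have h1 : ∑ v ∈ T₀, f (Sum.inr v) sink ≤ ∑ a ∈ T, ∑ b ∈ Tᶜ, f a b := by
      rw [hT, Finset.sum_map]
      refine Finset.sum_le_sum fun v _ => ?_
      exact Finset.single_le_sum (f := fun b => f (Sum.inr v) b) (fun b _ => hf.nonneg _ _)
        (Finset.mem_compl.2 ht)
    refine le_trans ?_ h1
    rw [sum_vertices]
    have h2 : 0 ≤ ∑ g ∈ grpsOf T₀, f (grpNode g) sink :=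
      Finset.sum_nonneg fun g _ => hf.nonneg _ _
    have h3 : ∑ j ∈ J, f (varNode j) sink ≤ ∑ j ∈ varsOf T₀, f (varNode j) sink := by
      refine Finset.sum_le_sum_of_subset_of_nonneg (fun j hj => ?_) fun j _ _ => hf.nonneg _ _
      rw [mem_varsOf, hT₀, Finset.mem_filter]
      exact ⟨mem_varsOf.1 (hJ hj), j, hj, .refl⟩
    linarith
  have hin : ∑ a ∈ Tᶜ, ∑ b ∈ T, f a b ≤ coverWeight grp η lam (grpsOf U) J := by
    have h1 : ∑ a ∈ Tᶜ, ∑ b ∈ T, f a b = ∑ v ∈ T₀, f source (Sum.inr v) := by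
      rw [Finset.sum_eq_single_of_mem source (Finset.mem_compl.2 hs), hT, Finset.sum_map]
      · rfl
      · intro a ha has
        refine Finset.sum_eq_zero fun b hb => ?_
        obtain ⟨w, hw, rfl⟩ := Finset.mem_map.1 hb
        obtain ⟨hwU, j, hj, hwj⟩ := Finset.mem_filter.1 hw
        rcases a with (_ | _) | v
        · exact absurd rfl has
        · exact hf.eq_zero (hc.callGraph_out_of_sink V γ _)
        · by_cases hvV : v ∈ V
          · by_cases hvU : v ∈ U
            · refine hf.eq_zero ?_
              change callGraph c V γ (Sum.inr v) (Sum.inr w) = 0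
              rw [callGraph_inner hvV (hUV hwU)]
              by_contra hne
              refine Finset.mem_compl.1 ha (Finset.mem_map.2 ⟨v, Finset.mem_filter.2 ⟨hvU, j, hj, ?_⟩,
                rfl⟩)
              exact .head (pos_iff_ne_zero.2 hne) hwj
            · exact hback v hvV hvU w hwU
          · exact hf.eq_zero (callGraph_of_notMem_left hvV _)
    rw [h1, sum_vertices, Finset.sum_eq_zero fun j _ => hf.eq_zero (hc.callGraph_source_var V γ j),
      zero_add, coverWeight]
    refine (Finset.sum_le_sum (g := fun g => lam * η g) fun g hg => ?_).trans
      (Finset.sum_le_sum_of_subset_of_nonneg (fun g hg => ?_) fun g _ _ => hη g)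
    · have hgV := hUV (Finset.mem_filter.1 (mem_grpsOf.1 hg)).1
      rw [← ENNReal.ofReal_le_ofReal_iff (hη g), ← hc.callGraph_source_grp (γ := γ) hgV]
      exact hf.le_cap _ _
    · obtain ⟨hgU, j, hj, hgj⟩ := Finset.mem_filter.1 (mem_grpsOf.1 hg)
      exact Finset.mem_filter.2 ⟨mem_grpsOf.2 hgU, j, hj, hc.mem_of_reachable hgj⟩
  linarith

theorem IsFlow.le_sink_capacity {V : Finset (Vertex p κ)} {γ : Fin p → ℝ}
    {f : Node p κ → Node p κ → ℝ} (hf : IsFlow (callGraph c V γ) source sink f) {j : Fin p}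
    (hj : j ∈ varsOf V) (hγ : 0 ≤ γ j) : f (varNode j) sink ≤ γ j := by
  rw [← ENNReal.ofReal_le_ofReal_iff hγ, ← callGraph_var_sink (c := c) (mem_varsOf.1 hj)]
  exact hf.le_cap _ _

theorem IsMaxFlow.eq_sink_capacity {V : Finset (Vertex p κ)} {γ : Fin p → ℝ}
    {f : Node p κ → Node p κ → ℝ} (hf : IsMaxFlow (callGraph c V γ) source sink f)
    {S : Finset (Node p κ)} (hS : IsMinCut (callGraph c V γ) source sink S) {j : Fin p}
    (hj : j ∈ varsOf (plusPart V S)) (hγ : 0 ≤ γ j) : f (varNode j) sink = γ j := by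
  obtain ⟨hjV, hjS⟩ := mem_plusPart.1 (mem_varsOf.1 hj)
  have h := (hf.saturates hS).1 _ hjS _ hS.2.1
  rw [callGraph_var_sink hjV] at h
  exact (ENNReal.ofReal_eq_ofReal_iff (hf.1.nonneg _ _) hγ).1 h

/-- The groups on the sink side of a minimum cut send their whole capacity to the variables on the
sink side. -/
theorem IsEquivalentGraph.capacity_le_flow_minus (hc : IsEquivalentGraph grp η lam c)
    (hη : ∀ g, 0 ≤ lam * η g) {V : Finset (Vertex p κ)} {γ : Fin p → ℝ}
    {f : Node p κ → Node p κ → ℝ} (hf : IsMaxFlow (callGraph c V γ) source sink f)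
    {S : Finset (Node p κ)} (hS : IsMinCut (callGraph c V γ) source sink S) :
    ∑ g ∈ grpsOf (minusPart V S), lam * η g ≤
      ∑ j ∈ varsOf (minusPart V S), f (varNode j) sink := by
  obtain ⟨hsat, hback⟩ := hf.saturates hS
  set T : Finset (Node p κ) := (minusPart V S).map Function.Embedding.inr with hT
  have hs : source ∉ T := by simp [hT]
  have ht : sink ∉ T := by simp [hT]
  have hbal := hf.1.inflow_eq_outflow hs ht
  have hin : ∑ g ∈ grpsOf (minusPart V S), lam * η g ≤ ∑ a ∈ Tᶜ, ∑ b ∈ T, f a b := by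
    refine le_trans ?_ (Finset.single_le_sum (f := fun a => ∑ b ∈ T, f a b)
      (fun a _ => Finset.sum_nonneg fun b _ => hf.1.nonneg a b) (Finset.mem_compl.2 hs))
    rw [hT, Finset.sum_map]
    change _ ≤ ∑ v ∈ minusPart V S, f source (Sum.inr v)
    rw [sum_vertices]
    have h0 : 0 ≤ ∑ j ∈ varsOf (minusPart V S), f source (varNode j) :=
      Finset.sum_nonneg fun j _ => hf.1.nonneg _ _
    have h1 : ∑ g ∈ grpsOf (minusPart V S), lam * η g =
        ∑ g ∈ grpsOf (minusPart V S), f source (grpNode g) := by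
      refine Finset.sum_congr rfl fun g hg => ?_
      obtain ⟨hgV, hgS⟩ := mem_minusPart.1 (mem_grpsOf.1 hg)
      have h := hsat _ hS.1 _ hgS
      rw [hc.callGraph_source_grp hgV] at h
      exact ((ENNReal.ofReal_eq_ofReal_iff (hf.1.nonneg _ _) (hη g)).1 h).symm
    linarith
  have hout : ∑ a ∈ T, ∑ b ∈ Tᶜ, f a b = ∑ j ∈ varsOf (minusPart V S), f (varNode j) sink := by
    have h1 : ∑ a ∈ T, ∑ b ∈ Tᶜ, f a b = ∑ v ∈ minusPart V S, f (Sum.inr v) sink := by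
      rw [hT, Finset.sum_map]
      refine Finset.sum_congr rfl fun v hv => ?_
      refine Finset.sum_eq_single_of_mem sink (Finset.mem_compl.2 ht) fun b hb hbt => ?_
      rcases b with (_ | _) | w
      · exact hf.1.eq_zero (hc.callGraph_into_source V γ _)
      · exact absurd rfl hbt
      · by_cases hw : w ∈ V
        · refine hback _ (mem_minusPart.1 hv).2 _ ?_
          by_contra hwS
          exact Finset.mem_compl.1 hb (Finset.mem_map.2 ⟨w, mem_minusPart.2 ⟨hw, hwS⟩, rfl⟩)
        · exact hf.1.eq_zero (callGraph_of_notMem_right hw _)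
    rw [h1, sum_vertices, Finset.sum_eq_zero fun g _ => hf.1.eq_zero (hc.callGraph_grp_sink V γ g),
      add_zero]
  linarith

end Graphs

/-! ### Tight vectors and their gluing along a cut -/

section Decomposition

variable {p : ℕ} {κ : Type*} {grp : κ → Finset (Fin p)} {η : κ → ℝ} {lam : ℝ} {u : Fin p → ℝ}

/-- On the variables of `A`, the vector `ξ` lies in the polymatroid of the groups of `H` and is tight
on the level sets of the non-negative residual `u - ξ`. -/
structure IsTight (grp : κ → Finset (Fin p)) (η : κ → ℝ) (lam : ℝ) (u : Fin p → ℝ) (H : Finset κ)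
    (A : Finset (Fin p)) (ξ : Fin p → ℝ) : Prop where
  nonneg : ∀ j ∈ A, 0 ≤ ξ j
  le : ∀ j ∈ A, ξ j ≤ u j
  cover : ∀ J ⊆ A, ∑ j ∈ J, ξ j ≤ coverWeight grp η lam H J
  tight : ∀ t, 0 < t → coverWeight grp η lam H (A.filter fun j => t ≤ u j - ξ j) ≤
    ∑ j ∈ A with t ≤ u j - ξ j, ξ j

theorem IsTight.congr {H : Finset κ} {A : Finset (Fin p)} {ξ ξ' : Fin p → ℝ}
    (h : IsTight grp η lam u H A ξ) (he : ∀ j ∈ A, ξ' j = ξ j) : IsTight grp η lam u H A ξ' where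
  nonneg j hj := he j hj ▸ h.nonneg j hj
  le j hj := he j hj ▸ h.le j hj
  cover J hJ := (Finset.sum_congr rfl fun j hj => he j (hJ hj)).trans_le (h.cover J hJ)
  tight t ht := by
    have h1 : (A.filter fun j => t ≤ u j - ξ' j) = A.filter fun j => t ≤ u j - ξ j :=
      Finset.filter_congr fun j hj => by rw [he j hj]
    rw [h1, Finset.sum_congr rfl fun j hj => he j (Finset.mem_of_mem_filter j hj)]
    exact h.tight t ht

theorem coverWeight_le_sum (hη : ∀ g, 0 ≤ lam * η g) (H : Finset κ) (J : Finset (Fin p)) :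
    coverWeight grp η lam H J ≤ ∑ g ∈ H, lam * η g :=
  Finset.sum_le_sum_of_subset_of_nonneg (Finset.filter_subset _ _) fun g _ _ => hη g

theorem coverWeight_le_of_subset (hη : ∀ g, 0 ≤ lam * η g) {H H' : Finset κ}
    {J J' : Finset (Fin p)} (h : ∀ g ∈ H, ∀ j ∈ J, j ∈ grp g → g ∈ H' ∧ ∃ i ∈ J', i ∈ grp g) :
    coverWeight grp η lam H J ≤ coverWeight grp η lam H' J' := by
  refine Finset.sum_le_sum_of_subset_of_nonneg (fun g hg => ?_) fun g _ _ => hη g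
  obtain ⟨hgH, j, hj, hjg⟩ := Finset.mem_filter.1 hg
  exact Finset.mem_filter.2 (h g hgH j hj hjg)

theorem coverWeight_union [DecidableEq κ] {H H' : Finset κ} (h : Disjoint H H')
    (J : Finset (Fin p)) :
    coverWeight grp η lam (H ∪ H') J = coverWeight grp η lam H J + coverWeight grp η lam H' J := by
  rw [coverWeight, Finset.filter_union, Finset.sum_union (Finset.disjoint_filter_filter h)]
  rfl

/-- The soft-thresholded vector is tight if it is feasible. -/
theorem isTight_soft_threshold (hu : ∀ j, 0 ≤ u j) (hη : ∀ g, 0 ≤ lam * η g) {H : Finset κ}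
    {A : Finset (Fin p)} {γ : Fin p → ℝ} {τ : ℝ} (hτ : 0 ≤ τ)
    (hγ : ∀ j ∈ A, γ j = max (u j - τ) 0)
    (hor : τ = 0 ∨ ∑ j ∈ A, γ j = lam * ∑ g ∈ H, η g)
    (hcover : ∀ J ⊆ A, ∑ j ∈ J, γ j ≤ coverWeight grp η lam H J) :
    IsTight grp η lam u H A γ where
  nonneg j hj := hγ j hj ▸ le_max_right _ _
  le j hj := hγ j hj ▸ max_le (by linarith) (hu j)
  cover := hcover
  tight t ht := by
    by_cases hne : ∃ j ∈ A, t ≤ u j - γ j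
    · obtain ⟨i, hi, hti⟩ := hne
      have htτ : t ≤ τ := by
        have := le_max_left (u i - τ) 0
        rw [← hγ i hi] at this
        linarith
      refine (coverWeight_le_sum hη _ _).trans ?_
      rw [← Finset.mul_sum, ← hor.resolve_left (by linarith), Finset.sum_filter]
      -- A coordinate with `γ_j > 0` has residual exactly `τ ≥ t`, so all the mass of `γ` lies in
      -- the level set.
      refine Finset.sum_le_sum fun j hj => ?_
      split_ifs with h
      · exact le_rfl
      · rw [hγ j hj] at h ⊢
        refine max_le ?_ le_rfl
        by_contra! hlt
        rw [max_eq_left hlt.le] at h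
        linarith
    · have hempty : (A.filter fun j => t ≤ u j - γ j) = ∅ :=
        Finset.filter_eq_empty_iff.2 fun j hj hle => hne ⟨j, hj, hle⟩
      rw [hempty]
      simp [coverWeight]

/-- On a level set above `τ` one has `ξ < u - τ ≤ γ`, so feasibility of `γ` would contradict
tightness of `ξ`. -/
theorem IsTight.residual_le {H : Finset κ} {A : Finset (Fin p)} {ξ γ : Fin p → ℝ} {τ : ℝ}
    (h : IsTight grp η lam u H A ξ) (hτ : 0 ≤ τ) (hγ : ∀ j ∈ A, u j - τ ≤ γ j)
    (hcover : ∀ J ⊆ A, ∑ j ∈ J, γ j ≤ coverWeight grp η lam H J) {j : Fin p} (hj : j ∈ A) :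
    u j - ξ j ≤ τ := by
  by_contra! hlt
  obtain ⟨i, hi, hmin⟩ := Finset.exists_min_image (A.filter fun j => τ < u j - ξ j)
    (fun j => u j - ξ j) ⟨j, Finset.mem_filter.2 ⟨hj, hlt⟩⟩
  obtain ⟨hiA, hiτ⟩ := Finset.mem_filter.1 hi
  have h1 := h.tight (u i - ξ i) (by linarith)
  have h2 := hcover _ (Finset.filter_subset (fun j => u i - ξ i ≤ u j - ξ j) A)
  have h3 : ∑ j ∈ A with u i - ξ i ≤ u j - ξ j, ξ j <
      ∑ j ∈ A with u i - ξ i ≤ u j - ξ j, γ j := by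
    refine Finset.sum_lt_sum_of_nonempty ⟨i, Finset.mem_filter.2 ⟨hiA, le_rfl⟩⟩ fun k hk => ?_
    obtain ⟨hkA, hk⟩ := Finset.mem_filter.1 hk
    linarith [hγ k hkA]
  linarith

/-- On `{u - ξ ≥ τ}` tightness gives `ξ` at least the mass of `φ`. Off this set `ξ ≥ φ` pointwise,
strictly at a violating `j`. Then `ξ` would exceed the total capacity, which `φ` already reaches. -/
theorem IsTight.le_residual (hη : ∀ g, 0 ≤ lam * η g) {H : Finset κ} {B : Finset (Fin p)}
    {ξ φ : Fin p → ℝ} {τ : ℝ} (h : IsTight grp η lam u H B ξ)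
    (hφ : ∀ j ∈ B, φ j ≤ max (u j - τ) 0)
    (hcover : ∀ J ⊆ B, ∑ j ∈ J, φ j ≤ coverWeight grp η lam H J)
    (htotal : ∑ g ∈ H, lam * η g ≤ ∑ j ∈ B, φ j) {j : Fin p} (hj : j ∈ B) (hju : τ < u j) :
    τ ≤ u j - ξ j := by
  by_contra! hlt
  have hτ : 0 < τ := by linarith [h.le j hj]
  have h1 := h.tight τ hτ
  have h2 := hcover _ (Finset.filter_subset (fun j => τ ≤ u j - ξ j) B)
  have h3 : ∑ j ∈ B with ¬ τ ≤ u j - ξ j, φ j < ∑ j ∈ B with ¬ τ ≤ u j - ξ j, ξ j := by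
    refine Finset.sum_lt_sum (fun k hk => ?_) ⟨j, Finset.mem_filter.2 ⟨hj, not_le.2 hlt⟩, ?_⟩
    · obtain ⟨hkB, hk⟩ := Finset.mem_filter.1 hk
      exact (hφ k hkB).trans (max_le (by linarith) (h.nonneg k hkB))
    · have := hφ j hj
      rw [max_eq_left (by linarith)] at this
      linarith
  have h4 := Finset.sum_filter_add_sum_filter_not B (fun j => τ ≤ u j - ξ j) ξ
  have h5 := Finset.sum_filter_add_sum_filter_not B (fun j => τ ≤ u j - ξ j) φ
  have h6 := (h.cover B subset_rfl).trans (coverWeight_le_sum hη H B)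
  linarith

/-- Tight vectors for the two sides of a cut form a tight vector. -/
theorem IsTight.union [DecidableEq κ] (hη : ∀ g, 0 ≤ lam * η g) {H H' : Finset κ}
    {A B : Finset (Fin p)} (hHH' : Disjoint H H') (hAB : Disjoint A B)
    (hsep : ∀ g ∈ H, ∀ j ∈ B, j ∉ grp g) {ξ γ φ : Fin p → ℝ} {τ : ℝ} (hτ : 0 ≤ τ)
    (hγ : ∀ j ∈ A, u j - τ ≤ γ j)
    (hγc : ∀ J ⊆ A, ∑ j ∈ J, γ j ≤ coverWeight grp η lam H J)
    (hφ : ∀ j ∈ B, φ j ≤ max (u j - τ) 0)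
    (hφc : ∀ J ⊆ B, ∑ j ∈ J, φ j ≤ coverWeight grp η lam H' J)
    (htotal : ∑ g ∈ H', lam * η g ≤ ∑ j ∈ B, φ j)
    (hA : IsTight grp η lam u H A ξ) (hB : IsTight grp η lam u H' B ξ) :
    IsTight grp η lam u (H ∪ H') (A ∪ B) ξ where
  nonneg j hj := (Finset.mem_union.1 hj).elim (hA.nonneg j) (hB.nonneg j)
  le j hj := (Finset.mem_union.1 hj).elim (hA.le j) (hB.le j)
  cover J hJ := by
    have h1 : J = (J ∩ A) ∪ (J ∩ B) := by
      rw [← Finset.inter_union_distrib_left, Finset.inter_eq_left.2 hJ]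
    have h2 : Disjoint (J ∩ A) (J ∩ B) :=
      hAB.mono Finset.inter_subset_right Finset.inter_subset_right
    have h3 : ∑ j ∈ J, ξ j = ∑ j ∈ J ∩ A, ξ j + ∑ j ∈ J ∩ B, ξ j := by
      rw [← Finset.sum_union h2, ← h1]
    rw [h3, coverWeight_union hHH']
    refine add_le_add ((hA.cover _ Finset.inter_subset_right).trans ?_)
      ((hB.cover _ Finset.inter_subset_right).trans ?_) <;>
    exact coverWeight_le_of_subset hη fun g hg j hj hjg => ⟨hg, j, Finset.mem_of_mem_inter_left hj, hjg⟩
  tight t ht := by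
    have h1 := hA.tight t ht
    have h2 := hB.tight t ht
    rw [Finset.filter_union, Finset.sum_union (Finset.disjoint_filter_filter hAB),
      coverWeight_union hHH']
    refine add_le_add (le_trans ?_ h1) (le_trans ?_ h2)
    · refine coverWeight_le_of_subset hη fun g hg j hj hjg => ⟨hg, j, ?_, hjg⟩
      refine (Finset.mem_union.1 hj).resolve_right fun hjB => ?_
      exact hsep g hg j (Finset.mem_of_mem_filter j hjB) hjg
    · rcases le_or_gt t τ with htτ | htτ
      · refine (coverWeight_le_sum hη _ _).trans (htotal.trans (le_trans ?_
          (hφc _ (Finset.filter_subset _ B))))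
        rw [Finset.sum_filter]
        refine Finset.sum_le_sum fun j hj => ?_
        split_ifs with h
        · exact le_rfl
        · refine (hφ j hj).trans (max_le ?_ le_rfl)
          by_contra! hlt
          exact h (htτ.trans (hB.le_residual hη hφ hφc htotal hj (by linarith)))
      · refine coverWeight_le_of_subset hη fun g hg j hj hjg => ⟨hg, j, ?_, hjg⟩
        refine (Finset.mem_union.1 hj).resolve_left fun hjA => ?_
        obtain ⟨hjA, hjt⟩ := Finset.mem_filter.1 hjA
        linarith [hA.residual_le hτ hγ hγc hjA]

end Decomposition

/-! ### Correctness and termination of `computeFlow` -/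

section Algorithm

variable {p : ℕ} {κ : Type*} [Fintype κ] [DecidableEq κ] {grp : κ → Finset (Fin p)} {η : κ → ℝ}
  {lam : ℝ} {u : Fin p → ℝ} {c : Node p κ → Node p κ → ℝ≥0∞}

theorem IsEquivalentGraph.isTight_split (hc : IsEquivalentGraph grp η lam c)
    (hη : ∀ g, 0 ≤ lam * η g) (hu : ∀ j, 0 ≤ u j) {V : Finset (Vertex p κ)}
    (hV : InfinitelyConnected grp c V) {γ : Fin p → ℝ} {f : Node p κ → Node p κ → ℝ}
    (step : IsFlowStep η lam c u V γ f) {S : Finset (Node p κ)}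
    (hS : IsMinCut (callGraph c V γ) source sink S) {ξ : Fin p → ℝ}
    (hplus : IsTight grp η lam u (grpsOf (plusPart V S)) (varsOf (plusPart V S)) ξ)
    (hminus : IsTight grp η lam u (grpsOf (minusPart V S)) (varsOf (minusPart V S)) ξ) :
    IsTight grp η lam u (grpsOf V) (varsOf V) ξ := by
  obtain ⟨hproj, hf⟩ := step
  obtain ⟨τ, hτ, hγ, _, _⟩ := hproj.exists_threshold_eq hu
  have hplusV : varsOf (plusPart V S) ⊆ varsOf V := fun j hj =>
    mem_varsOf.2 (mem_plusPart.1 (mem_varsOf.1 hj)).1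
  have hminusV : varsOf (minusPart V S) ⊆ varsOf V := fun j hj =>
    mem_varsOf.2 (mem_minusPart.1 (mem_varsOf.1 hj)).1
  have hγ0 : ∀ j ∈ varsOf V, 0 ≤ γ j := fun j hj => hγ j hj ▸ le_max_right _ _
  have hsep : ∀ g ∈ grpsOf (plusPart V S), ∀ j ∈ varsOf (minusPart V S), j ∉ grp g := by
    intro g hg j hj hjg
    obtain ⟨hjV, hjS⟩ := mem_minusPart.1 (mem_varsOf.1 hj)
    exact hjS (mem_plusPart.1 (hc.group_subset_plus hS hV (mem_grpsOf.1 hg) hjV hjg)).2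
  rw [← grpsOf_plus_union_minus V S, ← varsOf_plus_union_minus V S]
  refine IsTight.union hη ?_ ?_ hsep (γ := γ) (φ := fun j => f (varNode j) sink) hτ
    (fun j hj => hγ j (hplusV hj) ▸ le_max_left _ _) (fun J hJ => ?_)
    (fun j hj => hγ j (hminusV hj) ▸ hf.1.le_sink_capacity (hminusV hj) (hγ0 j (hminusV hj)))
    (fun J hJ => ?_) (hc.capacity_le_flow_minus hη hf hS) hplus hminus
  · refine Finset.disjoint_left.2 fun g h1 h2 => ?_
    exact (mem_minusPart.1 (mem_grpsOf.1 h2)).2 (mem_plusPart.1 (mem_grpsOf.1 h1)).2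
  · refine Finset.disjoint_left.2 fun j h1 h2 => ?_
    exact (mem_minusPart.1 (mem_varsOf.1 h2)).2 (mem_plusPart.1 (mem_varsOf.1 h1)).2
  · rw [← Finset.sum_congr rfl fun j hj => hf.eq_sink_capacity hS (hJ hj) (hγ0 j (hplusV (hJ hj)))]
    refine hc.flow_le_coverWeight hη hf.1 (Finset.filter_subset _ _) (fun v hv hvU w hw => ?_) hJ
    exact (hf.saturates hS).2 _ (fun hvS => hvU (mem_plusPart.2 ⟨hv, hvS⟩)) _ (mem_plusPart.1 hw).2
  · refine (hc.flow_le_coverWeight hη hf.1 subset_rfl (fun v hv hvU => absurd hv hvU)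
      (hJ.trans hminusV)).trans ?_
    -- A group of `V` meeting `J` cannot lie in `V⁺`, by separation.
    refine coverWeight_le_of_subset hη fun g hg j hj hjg => ⟨?_, j, hj, hjg⟩
    rw [← grpsOf_plus_union_minus V S] at hg
    exact (Finset.mem_union.1 hg).resolve_left fun hgp => hsep g hgp j (hJ hj) hjg

/-- Whatever choices are made, the vector returned by `computeFlow` is tight. -/
theorem ComputeFlow.isTight (hc : IsEquivalentGraph grp η lam c) (hη : ∀ g, 0 ≤ lam * η g)
    (hu : ∀ j, 0 ≤ u j) {V : Finset (Vertex p κ)} {ξ : Fin p → ℝ}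
    (h : ComputeFlow η lam c u V ξ) (hV : InfinitelyConnected grp c V) :
    IsTight grp η lam u (grpsOf V) (varsOf V) ξ := by
  induction h with
  | done V γ f step eq =>
    obtain ⟨τ, hτ, hγ, _, hor⟩ := step.1.exists_threshold_eq hu
    refine (isTight_soft_threshold hu hη hτ hγ hor fun J hJ => ?_).congr eq
    rw [← Finset.sum_congr rfl fun j hj => eq j (hJ hj)]
    exact hc.flow_le_coverWeight hη step.2.1 subset_rfl (fun v hv hvU => absurd hv hvU) hJ
  | split V γ f S ξp ξm step ne cut _ _ ihp ihm =>
    refine hc.isTight_split hη hu hV step cut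
      ((ihp (hc.infinitelyConnected_plus cut hV)).congr fun j hj => if_pos hj)
      ((ihm (hc.infinitelyConnected_minus cut hV)).congr fun j hj => if_neg fun hj' => ?_)
    exact (mem_minusPart.1 (mem_varsOf.1 hj)).2 (mem_plusPart.1 (mem_varsOf.1 hj')).2

/-- If `V⁺ = V`, every sink arc is saturated. If `V⁻ = V`, the flow delivers the whole group
capacity, which bounds `∑ γ_j`. Either way the flow equals `γ`, and no recursive call is made. -/
theorem IsEquivalentGraph.recursiveCall_ssubset (hc : IsEquivalentGraph grp η lam c)
    (hη : ∀ g, 0 ≤ lam * η g) (hu : ∀ j, 0 ≤ u j) {W V : Finset (Vertex p κ)}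
    (h : RecursiveCall η lam c u W V) : W ⊂ V := by
  obtain ⟨γ, f, S, ⟨hproj, hf⟩, ⟨j, hj, hne⟩, hS, hW⟩ := h
  obtain ⟨τ, hτ, hγ, hle, _⟩ := hproj.exists_threshold_eq hu
  have hγ0 : ∀ j ∈ varsOf V, 0 ≤ γ j := fun j hj => hγ j hj ▸ le_max_right _ _
  rcases hW with rfl | rfl
  · refine Finset.ssubset_iff_subset_ne.2 ⟨Finset.filter_subset _ _, fun heq => hne ?_⟩
    exact hf.eq_sink_capacity hS (heq.symm ▸ hj) (hγ0 j hj)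
  · refine Finset.ssubset_iff_subset_ne.2 ⟨Finset.filter_subset _ _, fun heq => hne ?_⟩
    have h1 := hc.capacity_le_flow_minus hη hf hS
    rw [heq, ← Finset.mul_sum] at h1
    have h2 : ∀ j ∈ varsOf V, f (varNode j) sink ≤ γ j := fun j hj =>
      hf.1.le_sink_capacity hj (hγ0 j hj)
    exact (Finset.sum_eq_sum_iff_of_le h2).1
      (le_antisymm (Finset.sum_le_sum h2) (hle.trans h1)) j hj

theorem IsEquivalentGraph.exists_computeFlow (hc : IsEquivalentGraph grp η lam c)
    (hη : ∀ g, 0 ≤ lam * η g) (hu : ∀ j, 0 ≤ u j) (V : Finset (Vertex p κ)) :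
    ∃ ξ, ComputeFlow η lam c u V ξ := by
  induction V using Finset.strongInduction with
  | H V ih =>
    obtain ⟨γ, hγ⟩ := exists_isProjectionStep (η := η) (lam := lam) hu V
      (by rw [Finset.mul_sum]; exact Finset.sum_nonneg fun g _ => hη g)
    obtain ⟨f, hf⟩ := exists_isMaxFlow (s := source) (t := sink)
      (Finset.mem_singleton_self source) (by simp) (hc.cutCapacity_source_ne_top V γ)
    by_cases heq : ∀ j ∈ varsOf V, f (varNode j) sink = γ j
    · exact ⟨_, .done V γ f ⟨hγ, hf⟩ heq⟩
    · push Not at heq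
      obtain ⟨S, hS⟩ := exists_isMinCut (callGraph c V γ) (s := source) (t := sink) (by simp)
      obtain ⟨ξp, hp⟩ := ih _ (hc.recursiveCall_ssubset hη hu
        ⟨γ, f, S, ⟨hγ, hf⟩, heq, hS, Or.inl rfl⟩)
      obtain ⟨ξm, hm⟩ := ih _ (hc.recursiveCall_ssubset hη hu
        ⟨γ, f, S, ⟨hγ, hf⟩, heq, hS, Or.inr rfl⟩)
      exact ⟨_, .split V γ f S ξp ξm ⟨hγ, hf⟩ heq hS hp hm⟩

end Algorithm

theorem mainTheorem1 {p : ℕ} {κ : Type*} [Fintype κ] [DecidableEq κ]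
    (grp : κ → Finset (Fin p)) (η : κ → ℝ) (hη : ∀ g, 0 < η g) (lam : ℝ) (hlam : 0 ≤ lam)
    (u : Fin p → ℝ) (c : Node p κ → Node p κ → ℝ≥0∞)
    (hc : c = canonicalGraph grp η lam ∨ IsEquivalentGraph grp η lam c) :
    Acc (RecursiveCall η lam c (fun j => |u j|)) Finset.univ ∧
    (∃ w, AlgorithmReturns η lam c u w) ∧
    ∀ w, AlgorithmReturns η lam c u w → IsProx grp η lam u w := by
  have hc' : IsEquivalentGraph grp η lam c := by
    rcases hc with rfl | hc
    · exact canonicalGraph_isEquivalentGraph grp η lam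
    · exact hc
  have hη' : ∀ g, 0 ≤ lam * η g := fun g => mul_nonneg hlam (hη g).le
  have hu : ∀ j, 0 ≤ |u j| := fun j => abs_nonneg _
  refine ⟨?_, ?_, ?_⟩
  · exact Subrelation.accessible (fun h => hc'.recursiveCall_ssubset hη' hu h)
      (wellFounded_lt.apply (Finset.univ : Finset (Vertex p κ)))
  · obtain ⟨ξ, hξ⟩ := hc'.exists_computeFlow hη' hu Finset.univ
    exact ⟨_, ξ, hξ, rfl⟩
  · rintro w ⟨ξ, hξ, rfl⟩
    have h := hξ.isTight hc' hη' hu hc'.infinitelyConnected_univ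
    have hvars : varsOf (Finset.univ : Finset (Vertex p κ)) = Finset.univ := by
      ext j
      simp [mem_varsOf]
    have hgrps : grpsOf (Finset.univ : Finset (Vertex p κ)) = Finset.univ := by
      ext g
      simp [mem_grpsOf]
    rw [hvars, hgrps] at h
    exact isProx_of_tight (fun j => h.nonneg j (Finset.mem_univ j))
      (fun j => h.le j (Finset.mem_univ j)) (fun J => h.cover J (Finset.subset_univ J)) h.tight
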